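/- Let $\langle y\rangle=(1+|y|^2)^{1/2}$ and let $X$ be the set of functions $f\in C^2(\mathbb R;\mathbb C)$ for which $\langle y\rangle^{1/2}f$ and $\langle y\rangle^{-1/2}f'$ are bounded on $\mathbb R$. There is a profile $Q\in X$ such that $$u(t,x)=t^{-1/4}Q(t^{-1/2}x)$$ is a classical solution (jointly $C^1$ on $[1,\infty)\times\mathbb R$, and $C^2$ in $x$) of the derivative nonlinear Schrödinger equation $$i\partial_t u+\partial_x^2u+i\partial_x(|u|^2u)=0,\qquad t\ge 1,\ x\in\mathbb R,\qquad u(1,x)=Q(x).$$ Moreover, there are nonzero real constants $Q_+,Q_-$ and continuous functions $\omega_\pm,\phi_\pm:(0,\infty)\to\mathbb R$ with $\lim_{\eta\to\infty}\omega_\pm(\eta)=-\infty$ such that $$Q(y)=Q_+|y|^{-1/2}\cos(\omega_+(y^2))e^{i\phi_+(y^2)}+O(|y|^{-1})\quad\text{as }y\to+\infty,$$ $$Q(y)=Q_-|y|^{-1/2}\cos(\omega_-(y^2))e^{i\phi_-(y^2)}+O(|y|^{-1})\quad\text{as }y\to-\infty.$$ Consequently, for the same $Q_\pm,\omega_\pm,\phi_\pm$,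 there are constants $C,K>0$ such that for all $t\ge1$ $$\bigl|u(t,x)-Q_+|x|^{-1/2}\cos(\omega_+(x^2/t))e^{i\phi_+(x^2/t)}\bigr|\le Ct^{1/2}|x|^{-1}\quad\text{if }x\ge Kt^{1/2},$$ $$\bigl|u(t,x)-Q_-|x|^{-1/2}\cos(\omega_-(x^2/t))e^{i\phi_-(x^2/t)}\bigr|\le Ct^{1/2}|x|^{-1}\quad\text{if }x\le -Kt^{1/2}.$$ -/

import Mathlib

open Set Filter Topology Asymptotics

noncomputable section

/-- The bracket `⟨y⟩ = (1 + |y|²)^{1/2}`. -/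
def japaneseBracket (y : ℝ) : ℝ := Real.sqrt (1 + |y| ^ 2)

/-- The space `X` of (complex-valued) `C²` functions `f` on the line for which `⟨·⟩^{1/2} f` and
`⟨·⟩^{-1/2} f'` are bounded (these functions being continuous, this is membership in `L^∞`). -/
def profileSpace : Set (ℝ → ℂ) :=
  {f | ContDiff ℝ 2 f ∧
    (∃ C : ℝ, ∀ y : ℝ, japaneseBracket y ^ (1 / 2 : ℝ) * ‖f y‖ ≤ C) ∧
    (∃ C : ℝ, ∀ y : ℝ, japaneseBracket y ^ (-(1 / 2) : ℝ) * ‖deriv f y‖ ≤ C)}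

/-- `u` is a classical solution of the Cauchy problem for the derivative nonlinear Schrödinger
equation `i ∂ₜu + ∂ₓ²u + i ∂ₓ(|u|²u) = 0`, `t ≥ 1`, `x ∈ ℝ`, with `u(1, x) = u₀(x)`.
The time derivative is the one along `[1, ∞)` (one-sided at `t = 1`). -/
structure IsDNLSSolution (u : ℝ → ℝ → ℂ) (u₀ : ℝ → ℂ) : Prop where
  contDiffOn : ContDiffOn ℝ 1 (fun p : ℝ × ℝ => u p.1 p.2) (Ici 1 ×ˢ univ)
  contDiff_space : ∀ t : ℝ, 1 ≤ t → ContDiff ℝ 2 (u t)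
  equation : ∀ t : ℝ, 1 ≤ t → ∀ x : ℝ,
    Complex.I * derivWithin (fun s => u s x) (Ici 1) t
      + iteratedDeriv 2 (u t) x
      + Complex.I * deriv (fun z => (‖u t z‖ : ℂ) ^ 2 * u t z) x = 0
  initial : ∀ x : ℝ, u 1 x = u₀ x

/-- The self-similar function `u(t, x) = t^{-1/4} Q(t^{-1/2} x)` with profile `Q`. -/
def selfSimilar (Q : ℝ → ℂ) (t x : ℝ) : ℂ :=
  ((t ^ (-(1 / 4) : ℝ) : ℝ) : ℂ) * Q (t ^ (-(1 / 2) : ℝ) * x)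

/-- The leading term `a |r|^{-1/2} cos(ω(η)) e^{i φ(η)}`. -/
def leadingTerm (a : ℝ) (ω φ : ℝ → ℝ) (r η : ℝ) : ℂ :=
  ((a * |r| ^ (-(1 / 2) : ℝ) * Real.cos (ω η) : ℝ) : ℂ) * Complex.exp (Complex.I * (φ η : ℂ))

end

/-! Inserting the self-similar ansatz gives the profile equation `Q'' - (i/2)(y Q' + Q/2) +
i(|Q|²Q)' = 0`. With `Q = ρ e^{iφ}`, `ρ` real and allowed to change sign, the choice `φ' = y/4 -
3ρ²/4` kills the imaginary part. The real part becomes `ρ'' = -(ρ/16)(y - 3ρ²)(y - ρ²)`.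

This is a Hamiltonian equation with nonnegative energy `ρ'²/2 + ρ²(y - ρ²)²/32`, which grows at most
exponentially in either direction, so solutions are global (`exists_modulus_solution`).

For large `x = |y|` the linear part is `ρ'' = -(x²/16)ρ`, whose WKB solutions have amplitude
`x^{-1/2}` and phase about `x²/8`. The squared amplitude `xρ² + 16ρ'²/x` is compared with
`correctedEnergy`, that is `32/x` times the energy plus `16ρρ'/x²`. The extra term cancels the
oscillating `O(1/x)` part of the derivative and leaves `O(x⁻³)`. For `y < 0` the remaining quartic
and sextic terms have a favourable sign. For `y > 0` a continuity argument from small data at `y =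
4` controls them. Hence the amplitude converges to a positive limit at rate `x⁻²`
(`exists_limit_sqAmplitude`), and a polar angle in the plane of `(xρ, -4ρ')` supplies the cosine
(`exists_angle`). The phase of `Q` is exactly `φ`, so the only error is in `ρ`; rescaling gives the
statement for `u`. -/

/-! ### Global existence for planar systems under a priori bounds -/

/-- Coordinatewise truncation of the plane to the square `[-M, M]²`. -/
def squareClamp (M : ℝ) (x : ℝ × ℝ) : ℝ × ℝ := (max (-M) (min M x.1), max (-M) (min M x.2))

theorem lipschitzWith_squareClamp (M : ℝ) : LipschitzWith 1 (squareClamp M) := by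
  have h1 : LipschitzWith 1 fun x : ℝ × ℝ => max (-M) (min M x.1) :=
    (LipschitzWith.prod_fst.const_min M).const_max (-M)
  have h2 : LipschitzWith 1 fun x : ℝ × ℝ => max (-M) (min M x.2) :=
    (LipschitzWith.prod_snd.const_min M).const_max (-M)
  simpa using! h1.prodMk h2

theorem norm_squareClamp_le {M : ℝ} (hM : 0 ≤ M) (x : ℝ × ℝ) : ‖squareClamp M x‖ ≤ M := by
  rw [Prod.norm_def]
  refine max_le ?_ ?_ <;> rw [Real.norm_eq_abs, abs_le] <;>
    exact ⟨le_max_left _ _, max_le (neg_le_self hM) (min_le_left _ _)⟩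

theorem squareClamp_eq_self {M : ℝ} {x : ℝ × ℝ} (hx : ‖x‖ ≤ M) : squareClamp M x = x := by
  rw [Prod.norm_def] at hx
  simp only [Real.norm_eq_abs, sup_le_iff, abs_le] at hx
  ext <;> simp [squareClamp, hx]

theorem exists_lipschitzOnWith_slice {F : ℝ → ℝ × ℝ → ℝ × ℝ}
    (hF : ContDiff ℝ 1 fun p : ℝ × (ℝ × ℝ) => F p.1 p.2) (a b M : ℝ) :
    ∃ K : NNReal, ∀ t ∈ Icc a b, LipschitzOnWith K (F t) (Metric.closedBall 0 M) := by
  obtain ⟨K, hK⟩ := (hF.contDiffOn (s := Icc a b ×ˢ Metric.closedBall (0 : ℝ × ℝ) M)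
    ).exists_lipschitzOnWith one_ne_zero ((convex_Icc a b).prod (convex_closedBall _ _))
    (isCompact_Icc.prod (isCompact_closedBall _ _))
  refine ⟨K, fun t ht x hx y hy => ?_⟩
  have := hK (mk_mem_prod ht hx) (mk_mem_prod ht hy)
  simpa [Prod.edist_eq] using this

/-- Solutions of a planar system that satisfy an a priori bound on a symmetric interval exist there. -/
theorem exists_solution_Icc_of_apriori {F : ℝ → ℝ × ℝ → ℝ × ℝ}
    (hF : ContDiff ℝ 1 fun p : ℝ × (ℝ × ℝ) => F p.1 p.2) (t₀ : ℝ) (x₀ : ℝ × ℝ) {T M : ℝ}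
    (hT : 0 < T)
    (hM : ∀ r : ℝ, 0 ≤ r → r ≤ T → ∀ α : ℝ → ℝ × ℝ, α t₀ = x₀ →
      (∀ t ∈ Icc (t₀ - r) (t₀ + r), HasDerivWithinAt α (F t (α t)) (Icc (t₀ - r) (t₀ + r)) t) →
      ∀ t ∈ Icc (t₀ - r) (t₀ + r), ‖α t‖ ≤ M) :
    ∃ α : ℝ → ℝ × ℝ, α t₀ = x₀ ∧
      (∀ t ∈ Icc (t₀ - T) (t₀ + T),
        HasDerivWithinAt α (F t (α t)) (Icc (t₀ - T) (t₀ + T)) t) ∧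
      ∀ t ∈ Icc (t₀ - T) (t₀ + T), ‖α t‖ ≤ M := by
  have hx₀ : ‖x₀‖ ≤ M := by
    refine hM 0 le_rfl hT.le (fun _ => x₀) rfl (fun t ht => ?_) t₀ (by simp)
    have : Icc (t₀ - 0) (t₀ + 0) = {t₀} := by simp
    rw [this] at ht ⊢
    rw [mem_singleton_iff.1 ht]
    exact HasFDerivWithinAt.singleton
  have hM0 : 0 ≤ M := (norm_nonneg _).trans hx₀
  obtain ⟨K, hK⟩ := exists_lipschitzOnWith_slice hF (t₀ - T) (t₀ + T) (M + 1)
  obtain ⟨B, hB⟩ := ((isCompact_Icc (a := t₀ - T) (b := t₀ + T)).prod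
    (isCompact_closedBall (0 : ℝ × ℝ) (M + 1))).exists_bound_of_continuousOn hF.continuous.continuousOn
  have hclamp : ∀ x, squareClamp (M + 1) x ∈ Metric.closedBall (0 : ℝ × ℝ) (M + 1) := fun x => by
    simpa using norm_squareClamp_le (by linarith) x
  have ht₀ : t₀ ∈ Icc (t₀ - T) (t₀ + T) := ⟨by linarith, by linarith⟩
  have hB0 : 0 ≤ B := (norm_nonneg _).trans (hB (t₀, squareClamp (M + 1) x₀) ⟨ht₀, hclamp _⟩)
  -- The truncated field is bounded by `B` and Lipschitz on the whole plane, so radius `B * T` lets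
  -- Picard–Lindelöf cover the full interval at once.
  have hPL : IsPicardLindelof (fun t x => F t (squareClamp (M + 1) x))
      (tmin := t₀ - T) (tmax := t₀ + T) ⟨t₀, ht₀⟩ x₀ (B.toNNReal * T.toNNReal) 0 B.toNNReal K := by
    refine ⟨fun t ht => ?_, fun x _ => ?_, fun t ht x _ => ?_, ?_⟩
    · have := (hK t ht).comp (lipschitzWith_squareClamp (M + 1)).lipschitzOnWith
        (s := Metric.closedBall x₀ (B.toNNReal * T.toNNReal)) (fun x _ => hclamp x)
      simpa using! this
    · have : Continuous fun t => F t (squareClamp (M + 1) x) :=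
        hF.continuous.comp (continuous_id.prodMk continuous_const)
      exact this.continuousOn
    · rw [Real.coe_toNNReal _ hB0]
      exact hB (t, _) ⟨ht, hclamp x⟩
    · simp [hT.le]
  obtain ⟨α, hα0, hα⟩ := hPL.exists_eq_forall_mem_Icc_hasDerivWithinAt₀
  have hαc : ContinuousOn α (Icc (t₀ - T) (t₀ + T)) := fun t ht => (hα t ht).continuousWithinAt
  have hshort : ∀ r, 0 ≤ r → r ≤ T → (∀ t ∈ Icc (t₀ - r) (t₀ + r), ‖α t‖ ≤ M + 1) →
      ∀ t ∈ Icc (t₀ - r) (t₀ + r), ‖α t‖ ≤ M := by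
    intro r hr hrT hb
    refine hM r hr hrT α hα0 fun t ht => ?_
    have hsub : Icc (t₀ - r) (t₀ + r) ⊆ Icc (t₀ - T) (t₀ + T) :=
      Icc_subset_Icc (by linarith) (by linarith)
    have := (hα t (hsub ht)).mono hsub
    rwa [squareClamp_eq_self (hb t ht)] at this
  -- The truncation is never felt. Take the time `s` closest to `t₀` at which the norm reaches `M +
  -- 1`: strictly closer to `t₀` the a priori bound gives `M`, and continuity carries this bound to
  -- `s`.
  have hlt : ∀ t ∈ Icc (t₀ - T) (t₀ + T), ‖α t‖ < M + 1 := by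
    by_contra! hcon
    obtain ⟨t₁, ht₁, hn₁⟩ := hcon
    have hZc : IsCompact (Icc (t₀ - T) (t₀ + T) ∩ (fun t => ‖α t‖) ⁻¹' Ici (M + 1)) :=
      isCompact_Icc.of_isClosed_subset
        (hαc.norm.preimage_isClosed_of_isClosed isClosed_Icc isClosed_Ici) inter_subset_left
    obtain ⟨s, ⟨hsI, hsn⟩, hmin⟩ := hZc.exists_isMinOn ⟨t₁, ht₁, hn₁⟩
      (f := fun t => |t - t₀|) (by fun_prop)
    have hsn' : M + 1 ≤ ‖α s‖ := hsn
    have hsT : |s - t₀| ≤ T := abs_le.2 ⟨by linarith [hsI.1], by linarith [hsI.2]⟩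
    have hinner : ∀ t, |t - t₀| < |s - t₀| → ‖α t‖ ≤ M := by
      intro t ht
      refine hshort |t - t₀| (abs_nonneg _) (ht.le.trans hsT) (fun t' ht' => ?_) t
        ⟨by linarith [neg_abs_le (t - t₀)], by linarith [le_abs_self (t - t₀)]⟩
      by_contra! hc
      have h1 : |t' - t₀| ≤ |t - t₀| := abs_le.2 ⟨by linarith [ht'.1], by linarith [ht'.2]⟩
      have h2 := hmin (a := t') ⟨⟨by linarith [ht'.1], by linarith [ht'.2]⟩, hc.le⟩
      have h2' : |s - t₀| ≤ |t' - t₀| := h2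
      linarith
    have hs0 : 0 < |s - t₀| := by
      rw [abs_pos, sub_ne_zero]
      rintro rfl
      rw [hα0] at hsn'
      linarith
    have hsub : Metric.ball t₀ |s - t₀| ⊆ Icc (t₀ - T) (t₀ + T) := fun t ht => by
      rw [Metric.mem_ball, Real.dist_eq] at ht
      obtain ⟨h1, h2⟩ := abs_lt.1 ht
      exact ⟨by linarith, by linarith⟩
    have hcl : s ∈ closure (Metric.ball t₀ |s - t₀|) := by
      rw [closure_ball _ hs0.ne', Metric.mem_closedBall, Real.dist_eq]
    have : ‖α s‖ ≤ M := by
      have hne : (𝓝[Metric.ball t₀ |s - t₀|] s).NeBot := mem_closure_iff_nhdsWithin_neBot.1 hcl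
      refine le_of_tendsto ((hαc s hsI).mono hsub).norm ?_
      filter_upwards [self_mem_nhdsWithin] with t ht
      exact hinner t (by simpa [Real.dist_eq] using ht)
    linarith
  have hle := hshort T hT.le le_rfl fun t ht => (hlt t ht).le
  refine ⟨α, hα0, fun t ht => ?_, hle⟩
  have := hα t ht
  rwa [squareClamp_eq_self (hlt t ht).le] at this

theorem eqOn_of_solutions {F : ℝ → ℝ × ℝ → ℝ × ℝ}
    (hF : ContDiff ℝ 1 fun p : ℝ × (ℝ × ℝ) => F p.1 p.2) {t₀ a b M : ℝ} (ht₀ : t₀ ∈ Ioo a b)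
    {α β : ℝ → ℝ × ℝ} (h₀ : α t₀ = β t₀)
    (hα : ∀ t ∈ Ioo a b, HasDerivAt α (F t (α t)) t ∧ ‖α t‖ ≤ M)
    (hβ : ∀ t ∈ Ioo a b, HasDerivAt β (F t (β t)) t ∧ ‖β t‖ ≤ M) : EqOn α β (Ioo a b) := by
  obtain ⟨K, hK⟩ := exists_lipschitzOnWith_slice hF a b M
  exact ODE_solution_unique_of_mem_Ioo (s := fun _ => Metric.closedBall 0 M) (K := K)
    (fun t ht => hK t (Ioo_subset_Icc_self ht)) ht₀
    (fun t ht => ⟨(hα t ht).1, by simpa using (hα t ht).2⟩)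
    (fun t ht => ⟨(hβ t ht).1, by simpa using (hβ t ht).2⟩) h₀

/-- Global existence for planar systems under a priori bounds on bounded time intervals. -/
theorem exists_global_solution_of_apriori {F : ℝ → ℝ × ℝ → ℝ × ℝ}
    (hF : ContDiff ℝ 1 fun p : ℝ × (ℝ × ℝ) => F p.1 p.2) (t₀ : ℝ) (x₀ : ℝ × ℝ)
    (hM : ∀ T : ℝ, 0 < T → ∃ M : ℝ, ∀ r : ℝ, 0 ≤ r → r ≤ T → ∀ α : ℝ → ℝ × ℝ, α t₀ = x₀ →
      (∀ t ∈ Icc (t₀ - r) (t₀ + r), HasDerivWithinAt α (F t (α t)) (Icc (t₀ - r) (t₀ + r)) t) →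
      ∀ t ∈ Icc (t₀ - r) (t₀ + r), ‖α t‖ ≤ M) :
    ∃ α : ℝ → ℝ × ℝ, α t₀ = x₀ ∧ ∀ t, HasDerivAt α (F t (α t)) t := by
  have hn : ∀ n : ℕ, ∃ α : ℝ → ℝ × ℝ, α t₀ = x₀ ∧ ∃ M, ∀ t ∈ Ioo (t₀ - (n + 1)) (t₀ + (n + 1)),
      HasDerivAt α (F t (α t)) t ∧ ‖α t‖ ≤ M := fun n => by
    obtain ⟨M, h⟩ := hM (n + 1) (by positivity)
    obtain ⟨α, h1, h2, h3⟩ := exists_solution_Icc_of_apriori hF t₀ x₀ (by positivity) h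
    exact ⟨α, h1, M, fun t ht => ⟨(h2 t (Ioo_subset_Icc_self ht)).hasDerivAt
      (Icc_mem_nhds ht.1 ht.2), h3 t (Ioo_subset_Icc_self ht)⟩⟩
  choose α hα0 M hα using hn
  have hmono : ∀ n m : ℕ, n ≤ m →
      EqOn (α n) (α m) (Ioo (t₀ - (n + 1)) (t₀ + (n + 1))) := fun n m hnm => by
    have hc : (n : ℝ) ≤ m := by exact_mod_cast hnm
    have hn0 : (0 : ℝ) ≤ n := by positivity
    refine eqOn_of_solutions hF (t₀ := t₀) (M := max (M n) (M m)) ⟨by linarith, by linarith⟩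
      (by rw [hα0, hα0])
      (fun t ht => ⟨(hα n t ht).1, (hα n t ht).2.trans (le_max_left _ _)⟩) (fun t ht => ?_)
    have := hα m t ⟨by linarith [ht.1], by linarith [ht.2]⟩
    exact ⟨this.1, this.2.trans (le_max_right _ _)⟩
  have hmem : ∀ t : ℝ, ∀ n : ℕ, |t - t₀| < n + 1 → t ∈ Ioo (t₀ - (n + 1)) (t₀ + (n + 1)) :=
    fun t n h => by
      obtain ⟨h1, h2⟩ := abs_lt.1 h
      exact ⟨by linarith, by linarith⟩
  have hceil : ∀ t : ℝ, t ∈ Ioo (t₀ - ((⌈|t - t₀|⌉₊ : ℝ) + 1)) (t₀ + ((⌈|t - t₀|⌉₊ : ℝ) + 1)) :=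
    fun t => hmem t _ (by linarith [Nat.le_ceil |t - t₀|])
  have heq : ∀ n : ℕ, EqOn (fun t => α ⌈|t - t₀|⌉₊ t) (α n)
      (Ioo (t₀ - (n + 1)) (t₀ + (n + 1))) := fun n t ht => by
    rcases le_total ⌈|t - t₀|⌉₊ n with h | h
    · exact hmono _ _ h (hceil t)
    · exact (hmono _ _ h ht).symm
  -- The half-width `n + 1` puts `t` strictly inside the window of index `⌈|t - t₀|⌉₊`, so the glued
  -- function agrees with a single solution near `t`.
  refine ⟨fun t => α ⌈|t - t₀|⌉₊ t, by simp [hα0], fun t => ?_⟩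
  have ht := hceil t
  refine (hα ⌈|t - t₀|⌉₊ t ht).1.congr_of_eventuallyEq ?_
  filter_upwards [isOpen_Ioo.mem_nhds ht] with s hs
  exact heq _ hs

/-! ### The modulus equation: energy and global solutions -/

/-- The first-order system for the (real) modulus `ρ` of the self-similar profile:
`ρ'' = -(ρ / 16) (y - 3ρ²) (y - ρ²)`. -/
noncomputable def modulusField (y : ℝ) (x : ℝ × ℝ) : ℝ × ℝ :=
  (x.2, -(x.1 / 16) * (y - 3 * x.1 ^ 2) * (y - x.1 ^ 2))

theorem contDiff_modulusField :
    ContDiff ℝ 1 fun p : ℝ × (ℝ × ℝ) => modulusField p.1 p.2 := by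
  unfold modulusField
  fun_prop

/-- A nonnegative energy for the modulus equation. -/
noncomputable def modulusEnergy (y : ℝ) (x : ℝ × ℝ) : ℝ := x.2 ^ 2 / 2 + x.1 ^ 2 * (y - x.1 ^ 2) ^ 2 / 32

/-- The potential `ρ²(y - ρ²)²/32` has `ρ`-derivative equal to minus the force, so only its explicit
dependence on `y` survives. -/
theorem hasDerivWithinAt_modulusEnergy {α : ℝ → ℝ × ℝ} {s : Set ℝ} {t : ℝ}
    (h : HasDerivWithinAt α (modulusField t (α t)) s t) :
    HasDerivWithinAt (fun t => modulusEnergy t (α t))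
      ((α t).1 ^ 2 * (t - (α t).1 ^ 2) / 16) s t := by
  have h1 : HasDerivWithinAt (fun t => (α t).1) (α t).2 s t :=
    (hasFDerivAt_fst (𝕜 := ℝ) (p := α t)).comp_hasDerivWithinAt t h
  have h2 : HasDerivWithinAt (fun t => (α t).2)
      (-((α t).1 / 16) * (t - 3 * (α t).1 ^ 2) * (t - (α t).1 ^ 2)) s t :=
    (hasFDerivAt_snd (𝕜 := ℝ) (p := α t)).comp_hasDerivWithinAt t h
  have := ((h2.pow 2).div_const 2).add
    (((h1.pow 2).mul (((hasDerivWithinAt_id t s).sub (h1.pow 2)).pow 2)).div_const 32)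
  refine this.congr_deriv ?_
  simp
  ring

theorem abs_modulusEnergy_deriv_le {t S p : ℝ} (h : |t| ≤ S - 1) (v : ℝ) :
    |p ^ 2 * (t - p ^ 2) / 16| ≤ 2 * (modulusEnergy t (p, v) + S) ∧
      p ^ 2 ≤ S + 32 * modulusEnergy t (p, v) := by
  obtain ⟨h1, h2⟩ := abs_le.1 h
  unfold modulusEnergy
  dsimp only
  have hS : 1 ≤ S := by linarith [abs_nonneg t]
  -- Once `p² > S`, the gap `p² - t` is at least 1 and the potential dominates `p²`.
  have hp : p ^ 2 ≤ S + p ^ 2 * (t - p ^ 2) ^ 2 := by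
    by_cases hs : p ^ 2 ≤ S
    · nlinarith [mul_nonneg (sq_nonneg p) (sq_nonneg (t - p ^ 2))]
    · have : 1 ≤ (t - p ^ 2) ^ 2 := by nlinarith
      nlinarith [mul_le_mul_of_nonneg_left this (sq_nonneg p)]
  refine ⟨?_, by nlinarith [sq_nonneg v]⟩
  rw [abs_le]
  constructor
  · nlinarith [mul_nonneg (sq_nonneg p) (sq_nonneg (t - p ^ 2 + 1)), sq_nonneg v]
  · nlinarith [mul_nonneg (sq_nonneg p) (sq_nonneg (t - p ^ 2 - 1)), sq_nonneg v]

/-- Grönwall's inequality in both time directions: `|E'| ≤ 2(E + S)` makes `(E + S)e^{-2t}` decrease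
and `(E + S)e^{2t}` increase. The energy then bounds both coordinates. -/
theorem modulus_apriori (t₀ : ℝ) (x₀ : ℝ × ℝ) (T : ℝ) (hT : 0 < T) :
    ∃ M : ℝ, ∀ r : ℝ, 0 ≤ r → r ≤ T → ∀ α : ℝ → ℝ × ℝ, α t₀ = x₀ →
      (∀ t ∈ Icc (t₀ - r) (t₀ + r),
        HasDerivWithinAt α (modulusField t (α t)) (Icc (t₀ - r) (t₀ + r)) t) →
      ∀ t ∈ Icc (t₀ - r) (t₀ + r), ‖α t‖ ≤ M := by
  set S := |t₀| + T + 1 with hSdef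
  have hS : 1 ≤ S := by linarith [abs_nonneg t₀]
  refine ⟨1 + S + 32 * ((modulusEnergy t₀ x₀ + S) * Real.exp (2 * T)), ?_⟩
  intro r hr hrT α hα0 hα
  set E : ℝ → ℝ := fun t => modulusEnergy t (α t) with hE
  have hd : ∀ t ∈ Icc (t₀ - r) (t₀ + r), HasDerivWithinAt E
      ((α t).1 ^ 2 * (t - (α t).1 ^ 2) / 16) (Icc (t₀ - r) (t₀ + r)) t :=
    fun t ht => hasDerivWithinAt_modulusEnergy (hα t ht)
  have hb : ∀ t ∈ Icc (t₀ - r) (t₀ + r), |(α t).1 ^ 2 * (t - (α t).1 ^ 2) / 16| ≤ 2 * (E t + S) ∧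
      (α t).1 ^ 2 ≤ S + 32 * E t := fun t ht => by
    refine abs_modulusEnergy_deriv_le (abs_le.2 ⟨?_, ?_⟩) _
    · linarith [neg_abs_le t₀, ht.1]
    · linarith [le_abs_self t₀, ht.2]
  have hexp : ∀ c t : ℝ, HasDerivWithinAt (fun t => Real.exp (c * t)) (Real.exp (c * t) * c)
      (Icc (t₀ - r) (t₀ + r)) t := fun c t => by
    simpa using! (((hasDerivAt_id t).const_mul c).exp).hasDerivWithinAt
  have hprod : ∀ c, ∀ t ∈ Icc (t₀ - r) (t₀ + r),
      HasDerivWithinAt (fun t => (E t + S) * Real.exp (c * t))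
        (((α t).1 ^ 2 * (t - (α t).1 ^ 2) / 16 + c * (E t + S)) * Real.exp (c * t))
        (Icc (t₀ - r) (t₀ + r)) t := fun c t ht =>
    (((hd t ht).add_const S).mul (hexp c t)).congr_deriv (by ring)
  have hint : interior (Icc (t₀ - r) (t₀ + r)) ⊆ Icc (t₀ - r) (t₀ + r) := interior_subset
  have hanti : AntitoneOn (fun t => (E t + S) * Real.exp (-2 * t)) (Icc (t₀ - r) (t₀ + r)) := by
    refine antitoneOn_of_hasDerivWithinAt_nonpos (convex_Icc _ _)
      (fun t ht => (hprod _ t ht).continuousWithinAt)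
      (fun t ht => (hprod _ t (hint ht)).mono hint) fun t ht => ?_
    refine mul_nonpos_of_nonpos_of_nonneg ?_ (Real.exp_pos _).le
    linarith [(abs_le.1 (hb t (hint ht)).1).2]
  have hmono : MonotoneOn (fun t => (E t + S) * Real.exp (2 * t)) (Icc (t₀ - r) (t₀ + r)) := by
    refine monotoneOn_of_hasDerivWithinAt_nonneg (convex_Icc _ _)
      (fun t ht => (hprod _ t ht).continuousWithinAt)
      (fun t ht => (hprod _ t (hint ht)).mono hint) fun t ht => ?_
    refine mul_nonneg ?_ (Real.exp_pos _).le
    linarith [(abs_le.1 (hb t (hint ht)).1).1]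
  have hE0 : E t₀ = modulusEnergy t₀ x₀ := by simp [hE, hα0]
  have hpos : ∀ t, 0 ≤ E t := fun t => by
    simp only [hE, modulusEnergy]; positivity
  have hkey : ∀ t ∈ Icc (t₀ - r) (t₀ + r), E t + S ≤ (modulusEnergy t₀ x₀ + S) * Real.exp (2 * T) := by
    intro t ht
    have ht₀ : t₀ ∈ Icc (t₀ - r) (t₀ + r) := ⟨by linarith, by linarith⟩
    have hcase : ∀ c, |c * (t - t₀)| ≤ 2 * T → (E t + S) * Real.exp (c * t) ≤ (E t₀ + S) * Real.exp (c * t₀) →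
        E t + S ≤ (modulusEnergy t₀ x₀ + S) * Real.exp (2 * T) := by
      intro c hc h
      have h1 : E t + S ≤ (E t₀ + S) * Real.exp (c * (t₀ - t)) := by
        rw [mul_sub, Real.exp_sub, ← mul_div_assoc, le_div_iff₀ (Real.exp_pos _)]
        exact h
      rw [hE0] at h1
      refine h1.trans (mul_le_mul_of_nonneg_left (Real.exp_le_exp.2 ?_) (by linarith [hpos t₀]))
      linarith [(abs_le.1 hc).1]
    rcases le_total t₀ t with h | h
    · refine hcase (-2) (abs_le.2 ⟨?_, ?_⟩) (hanti ht₀ ht h) <;> linarith [ht.1, ht.2]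
    · refine hcase 2 (abs_le.2 ⟨?_, ?_⟩) (hmono ht ht₀ h) <;> linarith [ht.1, ht.2]
  intro t ht
  have h1 := hkey t ht
  have h2 := (hb t ht).2
  have h3 : (α t).2 ^ 2 ≤ 2 * E t := by
    have : 0 ≤ (α t).1 ^ 2 * (t - (α t).1 ^ 2) ^ 2 := by positivity
    simp only [hE, modulusEnergy]
    linarith
  have hsq : ∀ z : ℝ, |z| ≤ 1 + z ^ 2 := fun z => abs_le.2 ⟨by nlinarith, by nlinarith⟩
  rw [Prod.norm_def, Real.norm_eq_abs, Real.norm_eq_abs]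
  have := hpos t
  refine max_le ((hsq _).trans ?_) ((hsq _).trans ?_) <;> linarith

/-- The modulus equation has a global solution for arbitrary initial data. -/
theorem exists_modulus_solution (t₀ : ℝ) (x₀ : ℝ × ℝ) :
    ∃ α : ℝ → ℝ × ℝ, α t₀ = x₀ ∧ ∀ t, HasDerivAt α (modulusField t (α t)) t :=
  exists_global_solution_of_apriori contDiff_modulusField t₀ x₀ (modulus_apriori t₀ x₀)

/-- A solution vanishing with its derivative at one time coincides with the zero solution by
uniqueness. This is what keeps the oscillation amplitude positive. -/
theorem modulus_ne_zero {α : ℝ → ℝ × ℝ} (hα : ∀ t, HasDerivAt α (modulusField t (α t)) t)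
    {t₀ : ℝ} (h₀ : α t₀ ≠ 0) (t : ℝ) : α t ≠ 0 := by
  intro ht
  apply h₀
  have hc : Continuous α := continuous_iff_continuousAt.2 fun t => (hα t).continuousAt
  set a := min t t₀ - 1
  set b := max t t₀ + 1
  have hat : t ∈ Ioo a b := ⟨by linarith [min_le_left t t₀], by linarith [le_max_left t t₀]⟩
  have hat₀ : t₀ ∈ Ioo a b := ⟨by linarith [min_le_right t t₀], by linarith [le_max_right t t₀]⟩
  obtain ⟨B, hB⟩ := (isCompact_Icc (a := a) (b := b)).exists_bound_of_continuousOn hc.continuousOn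
  have := eqOn_of_solutions contDiff_modulusField (M := max B 0) hat (α := α) (β := fun _ => 0)
    ht (fun s hs => ⟨hα s, (hB s (Ioo_subset_Icc_self hs)).trans (le_max_left _ _)⟩)
    (fun s _ => ⟨by
      have : modulusField s 0 = 0 := by simp [modulusField]
      rw [this]
      exact hasDerivAt_const s 0, by simp⟩)
  exact this hat₀

/-! ### Amplitude and corrected energy on a half-line -/

/-- The pair `(ρ, v)` solves the modulus equation along a half-line, in the variable `x = |y|`;
`σ = ±1` is the sign of `y`. -/
structure IsHalfLineModulus (σ : ℝ) (ρ v : ℝ → ℝ) : Prop where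
  sign : σ = 1 ∨ σ = -1
  hasDerivAt_fst : ∀ x, HasDerivAt ρ (v x) x
  hasDerivAt_snd : ∀ x, HasDerivAt v
    (-(ρ x / 16) * (x ^ 2 - 4 * σ * x * ρ x ^ 2 + 3 * ρ x ^ 4)) x
  ne_zero : ∀ x, ρ x ≠ 0 ∨ v x ≠ 0

/-- The squared amplitude `x ρ² + 16 v² / x` of the oscillation. -/
noncomputable def sqAmplitude (ρ v : ℝ → ℝ) (x : ℝ) : ℝ := x * ρ x ^ 2 + 16 * v x ^ 2 / x

/-- The corrected energy, which is almost conserved for large `x`. -/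
noncomputable def correctedEnergy (σ : ℝ) (ρ v : ℝ → ℝ) (x : ℝ) : ℝ :=
  16 * v x ^ 2 / x + ρ x ^ 2 * (x - σ * ρ x ^ 2) ^ 2 / x + 16 * (ρ x * v x) / x ^ 2

/-- The derivative of `correctedEnergy`. -/
noncomputable def correctedEnergyDeriv (σ : ℝ) (ρ v : ℝ → ℝ) (x : ℝ) : ℝ :=
  -(32 * (ρ x * v x)) / x ^ 3 + 4 * σ * ρ x ^ 4 / x - 4 * ρ x ^ 6 / x ^ 2

/-- Adding or subtracting `K/(2x²)` turns `f` into a decreasing or an increasing function. Every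
value of the latter lies below every value of the former, and the supremum of the latter serves as
`l`. -/
theorem exists_limit_of_abs_deriv_le {f f' : ℝ → ℝ} {a K : ℝ} (ha : 0 < a)
    (hf : ∀ x, a ≤ x → HasDerivAt f (f' x) x) (hK : ∀ x, a ≤ x → |f' x| ≤ K / x ^ 3) :
    ∃ l, ∀ x, a ≤ x → |f x - l| ≤ K / x ^ 2 := by
  have hK0 : 0 ≤ K := by
    have := (abs_nonneg _).trans (hK a le_rfl)
    rwa [le_div_iff₀ (by positivity), zero_mul] at this
  have hd : ∀ c x, a ≤ x → HasDerivAt (fun x => f x + c * (1 / x ^ 2)) (f' x - 2 * c / x ^ 3) x := by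
    intro c x hx
    have hx0 : x ≠ 0 := by linarith
    have := (hf x hx).add (((hasDerivAt_const x (1 : ℝ)).div ((hasDerivAt_id x).pow 2)
      (pow_ne_zero 2 hx0)).const_mul c)
    refine this.congr_deriv ?_
    simp
    field_simp
    ring
  have hanti : AntitoneOn (fun x => f x + K / 2 * (1 / x ^ 2)) (Ici a) := by
    refine antitoneOn_of_hasDerivWithinAt_nonpos (convex_Ici a)
      (fun x hx => (hd _ x hx).continuousAt.continuousWithinAt)
      (fun x hx => (hd _ x (interior_subset hx)).hasDerivWithinAt) fun x hx => ?_
    have := (abs_le.1 (hK x (interior_subset hx))).2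
    rw [show 2 * (K / 2) = K by ring]
    linarith
  have hmono : MonotoneOn (fun x => f x + -(K / 2) * (1 / x ^ 2)) (Ici a) := by
    refine monotoneOn_of_hasDerivWithinAt_nonneg (convex_Ici a)
      (fun x hx => (hd _ x hx).continuousAt.continuousWithinAt)
      (fun x hx => (hd _ x (interior_subset hx)).hasDerivWithinAt) fun x hx => ?_
    have := (abs_le.1 (hK x (interior_subset hx))).1
    rw [show 2 * -(K / 2) = -K by ring, neg_div]
    linarith
  set g := fun x => f x + -(K / 2) * (1 / x ^ 2)
  have hcross : ∀ x ∈ Ici a, ∀ y ∈ Ici a, g y ≤ f x + K / 2 * (1 / x ^ 2) := by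
    intro x hx y hy
    have h3 : x ⊔ y ∈ Ici a := le_trans hx (le_max_left x y)
    refine (hmono hy h3 (le_max_right x y)).trans (le_trans ?_ (hanti hx h3 (le_max_left x y)))
    have : 0 ≤ K / 2 * (1 / (x ⊔ y) ^ 2) := by positivity
    simp only [g]
    linarith
  refine ⟨sSup (g '' Ici a), fun x hx => ?_⟩
  have h1 : g x ≤ sSup (g '' Ici a) := by
    refine le_csSup ⟨f x + K / 2 * (1 / x ^ 2), ?_⟩ (mem_image_of_mem _ hx)
    rintro _ ⟨y, hy, rfl⟩
    exact hcross x hx y hy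
  have h2 : sSup (g '' Ici a) ≤ f x + K / 2 * (1 / x ^ 2) := by
    refine csSup_le ⟨_, mem_image_of_mem _ hx⟩ ?_
    rintro _ ⟨y, hy, rfl⟩
    exact hcross x hx y hy
  have h3 : K / x ^ 2 = K / 2 * (1 / x ^ 2) + K / 2 * (1 / x ^ 2) := by ring
  have h4 : 0 ≤ K / 2 * (1 / x ^ 2) := by positivity
  simp only [g] at h1
  rw [abs_le, h3]
  constructor <;> linarith

namespace IsHalfLineModulus

variable {σ : ℝ} {ρ v : ℝ → ℝ}

/-- The term `16ρv/x²` contributes `16v²/x² - ρ²` at leading order, which cancels the non-integrable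
part of the derivative of the uncorrected energy. -/
theorem hasDerivAt_correctedEnergy (h : IsHalfLineModulus σ ρ v) {x : ℝ} (hx : 0 < x) :
    HasDerivAt (correctedEnergy σ ρ v) (correctedEnergyDeriv σ ρ v x) x := by
  have h1 := h.hasDerivAt_fst x
  have h2 := h.hasDerivAt_snd x
  have hid := hasDerivAt_id x
  have := ((((h2.pow 2).const_mul 16).div hid hx.ne').add
    (((h1.pow 2).mul ((hid.sub ((h1.pow 2).const_mul σ)).pow 2)).div hid hx.ne')).add
    (((h1.mul h2).const_mul 16).div (hid.pow 2) (pow_ne_zero 2 hx.ne'))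
  refine this.congr_deriv ?_
  unfold correctedEnergyDeriv
  simp
  rcases h.sign with rfl | rfl <;> field_simp <;> ring

theorem continuous_fst (h : IsHalfLineModulus σ ρ v) : Continuous ρ :=
  continuous_iff_continuousAt.2 fun x => (h.hasDerivAt_fst x).continuousAt

theorem continuous_snd (h : IsHalfLineModulus σ ρ v) : Continuous v :=
  continuous_iff_continuousAt.2 fun x => (h.hasDerivAt_snd x).continuousAt

theorem sqAmplitude_pos (h : IsHalfLineModulus σ ρ v) {x : ℝ} (hx : 0 < x) :
    0 < sqAmplitude ρ v x := by
  unfold sqAmplitude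
  rcases h.ne_zero x with h | h
  · have : 0 < ρ x ^ 2 := by positivity
    positivity
  · have : 0 < v x ^ 2 := by positivity
    positivity

/-- If the corrected energy has relative growth rate at most `16 / x³`, it at most doubles. -/
theorem correctedEnergy_le_two_mul (h : IsHalfLineModulus σ ρ v) {X : ℝ} (hX : 4 ≤ X)
    (hpos : 0 ≤ correctedEnergy σ ρ v 4)
    (hG : ∀ x ∈ Icc 4 X, correctedEnergyDeriv σ ρ v x ≤ 16 * correctedEnergy σ ρ v x / x ^ 3) :
    correctedEnergy σ ρ v X ≤ 2 * correctedEnergy σ ρ v 4 := by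
  -- The integrating factor comes from `(8/x²)' = -16/x³`. At `x = 4` it equals `e^{1/2} ≤ 2`, which
  -- is the doubling constant.
  have hd : ∀ x ∈ Icc 4 X, HasDerivAt (fun x => correctedEnergy σ ρ v x * Real.exp (8 / x ^ 2))
      ((correctedEnergyDeriv σ ρ v x - 16 * correctedEnergy σ ρ v x / x ^ 3) *
        Real.exp (8 / x ^ 2)) x := by
    intro x hx
    have hx0 : 0 < x := by linarith [hx.1]
    have := (h.hasDerivAt_correctedEnergy hx0).mul
      (((hasDerivAt_const x (8 : ℝ)).div ((hasDerivAt_id x).pow 2) (pow_ne_zero 2 hx0.ne')).exp)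
    refine this.congr_deriv ?_
    simp
    field_simp
    ring
  have hanti : AntitoneOn (fun x => correctedEnergy σ ρ v x * Real.exp (8 / x ^ 2)) (Icc 4 X) := by
    refine antitoneOn_of_hasDerivWithinAt_nonpos (convex_Icc 4 X)
      (fun x hx => (hd x hx).continuousAt.continuousWithinAt)
      (fun x hx => (hd x (interior_subset hx)).hasDerivWithinAt) fun x hx => ?_
    exact mul_nonpos_of_nonpos_of_nonneg (by linarith [hG x (interior_subset hx)])
      (Real.exp_pos _).le
  have h1 := hanti (left_mem_Icc.2 hX) (right_mem_Icc.2 hX) hX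
  have h2 : Real.exp (8 / 4 ^ 2) ≤ 2 := by
    have h3 : Real.exp (8 / 4 ^ 2) ^ 2 ≤ 2 ^ 2 := by
      rw [← Real.exp_nat_mul]
      norm_num
      linarith [Real.exp_one_lt_d9]
    exact (pow_le_pow_iff_left₀ (Real.exp_pos _).le (by norm_num) two_ne_zero).1 h3
  have h3 : 1 ≤ Real.exp (8 / X ^ 2) := Real.one_le_exp (by positivity)
  simp only at h1
  by_contra! hc
  nlinarith [mul_le_mul_of_nonneg_left h2 hpos]

theorem eight_mul_abs_le {x : ℝ} (hx : 0 < x) : 8 * |ρ x * v x| ≤ sqAmplitude ρ v x := by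
  unfold sqAmplitude
  have h : ∀ s : ℝ, s = 1 ∨ s = -1 → 8 * (s * (ρ x * v x)) ≤ x * ρ x ^ 2 + 16 * v x ^ 2 / x := by
    intro s hs
    have hs2 : s ^ 2 = 1 := by rcases hs with rfl | rfl <;> norm_num
    have : x * ρ x ^ 2 + 16 * v x ^ 2 / x - 8 * (s * (ρ x * v x)) =
        (x * ρ x - 4 * s * v x) ^ 2 / x := by
      field_simp
      linear_combination (-16 * v x ^ 2) * hs2
    have h2 : 0 ≤ (x * ρ x - 4 * s * v x) ^ 2 / x := by positivity
    linarith
  rcases abs_cases (ρ x * v x) with ⟨h1, -⟩ | ⟨h1, -⟩ <;> rw [h1]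
  · linarith [h 1 (Or.inl rfl)]
  · linarith [h (-1) (Or.inr rfl)]

end IsHalfLineModulus

namespace IsHalfLineModulus

variable {σ : ℝ} {ρ v : ℝ → ℝ}

theorem mul_sq_le_sqAmplitude {x : ℝ} (hx : 0 < x) : x * ρ x ^ 2 ≤ sqAmplitude ρ v x := by
  unfold sqAmplitude
  have : 0 ≤ 16 * v x ^ 2 / x := by positivity
  linarith

theorem pow_four_le {x : ℝ} (hx : 0 < x) : ρ x ^ 4 ≤ sqAmplitude ρ v x ^ 2 / x ^ 2 := by
  rw [le_div_iff₀ (by positivity), show ρ x ^ 4 * x ^ 2 = (x * ρ x ^ 2) ^ 2 by ring]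
  exact pow_le_pow_left₀ (by positivity) (mul_sq_le_sqAmplitude hx) 2

theorem pow_six_le {x : ℝ} (hx : 0 < x) : ρ x ^ 6 ≤ sqAmplitude ρ v x ^ 3 / x ^ 3 := by
  rw [le_div_iff₀ (by positivity), show ρ x ^ 6 * x ^ 3 = (x * ρ x ^ 2) ^ 3 by ring]
  exact pow_le_pow_left₀ (by positivity) (mul_sq_le_sqAmplitude hx) 3

theorem correctedEnergy_sub_sqAmplitude (h : IsHalfLineModulus σ ρ v) {x : ℝ} (hx : 0 < x) :
    correctedEnergy σ ρ v x - sqAmplitude ρ v x =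
      -(2 * σ * ρ x ^ 4) + ρ x ^ 6 / x + 16 * (ρ x * v x) / x ^ 2 := by
  unfold correctedEnergy sqAmplitude
  rcases h.sign with rfl | rfl <;> field_simp <;> ring

theorem abs_correctedEnergy_sub_le (h : IsHalfLineModulus σ ρ v) {x : ℝ} (hx : 1 ≤ x) :
    |correctedEnergy σ ρ v x - sqAmplitude ρ v x| ≤
      (2 * sqAmplitude ρ v x + 2 * sqAmplitude ρ v x ^ 2 + sqAmplitude ρ v x ^ 3) / x ^ 2 := by
  have hx0 : 0 < x := by linarith
  have hN := h.sqAmplitude_pos hx0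
  rw [h.correctedEnergy_sub_sqAmplitude hx0]
  have h4 := pow_four_le (ρ := ρ) (v := v) hx0
  have h6 : ρ x ^ 6 / x ≤ sqAmplitude ρ v x ^ 3 / x ^ 2 := by
    refine (div_le_self (by positivity) hx).trans ((pow_six_le (v := v) hx0).trans ?_)
    gcongr
    norm_num
  have h1 : |16 * (ρ x * v x) / x ^ 2| ≤ 2 * sqAmplitude ρ v x / x ^ 2 := by
    rw [abs_div, abs_mul, abs_of_pos (by norm_num : (0 : ℝ) < 16),
      abs_of_pos (by positivity : 0 < x ^ 2)]
    refine (div_le_div_iff_of_pos_right (by positivity)).2 ?_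
    linarith [eight_mul_abs_le (ρ := ρ) (v := v) hx0]
  obtain ⟨h2, h3⟩ := abs_le.1 h1
  have h40 : 0 ≤ ρ x ^ 4 := by positivity
  have h60 : 0 ≤ ρ x ^ 6 / x := by positivity
  have hexp : (2 * sqAmplitude ρ v x + 2 * sqAmplitude ρ v x ^ 2 + sqAmplitude ρ v x ^ 3) / x ^ 2 =
    2 * sqAmplitude ρ v x / x ^ 2 + 2 * (sqAmplitude ρ v x ^ 2 / x ^ 2) +
      sqAmplitude ρ v x ^ 3 / x ^ 2 := by ring
  rw [hexp, abs_le]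
  rcases h.sign with rfl | rfl <;> constructor <;> linarith

theorem abs_cross_le {x : ℝ} (hx : 0 < x) :
    |-(32 * (ρ x * v x)) / x ^ 3| ≤ 4 * sqAmplitude ρ v x / x ^ 3 := by
  rw [abs_div, abs_neg, abs_mul, abs_of_pos (by norm_num : (0 : ℝ) < 32),
    abs_of_pos (by positivity : 0 < x ^ 3)]
  refine (div_le_div_iff_of_pos_right (by positivity)).2 ?_
  linarith [eight_mul_abs_le (ρ := ρ) (v := v) hx]

theorem abs_correctedEnergyDeriv_le (h : IsHalfLineModulus σ ρ v) {x : ℝ} (hx : 1 ≤ x) :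
    |correctedEnergyDeriv σ ρ v x| ≤
      4 * (sqAmplitude ρ v x + sqAmplitude ρ v x ^ 2 + sqAmplitude ρ v x ^ 3) / x ^ 3 := by
  have hx0 : 0 < x := by linarith
  have hN := h.sqAmplitude_pos hx0
  have h4 : ρ x ^ 4 / x ≤ sqAmplitude ρ v x ^ 2 / x ^ 3 := by
    rw [show sqAmplitude ρ v x ^ 2 / x ^ 3 = sqAmplitude ρ v x ^ 2 / x ^ 2 / x by field_simp]
    gcongr
    exact pow_four_le hx0
  have h6 : ρ x ^ 6 / x ^ 2 ≤ sqAmplitude ρ v x ^ 3 / x ^ 3 :=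
    (div_le_self (by positivity) (one_le_pow₀ hx)).trans (pow_six_le hx0)
  obtain ⟨h2, h3⟩ := abs_le.1 (abs_cross_le (ρ := ρ) (v := v) hx0)
  have h40 : 0 ≤ ρ x ^ 4 / x := by positivity
  have h60 : 0 ≤ ρ x ^ 6 / x ^ 2 := by positivity
  have hexp : 4 * (sqAmplitude ρ v x + sqAmplitude ρ v x ^ 2 + sqAmplitude ρ v x ^ 3) / x ^ 3 =
    4 * sqAmplitude ρ v x / x ^ 3 + 4 * (sqAmplitude ρ v x ^ 2 / x ^ 3) +
      4 * (sqAmplitude ρ v x ^ 3 / x ^ 3) := by ring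
  unfold correctedEnergyDeriv
  rw [hexp, abs_le, mul_div_assoc (4 * σ), mul_div_assoc 4 (ρ x ^ 6)]
  rcases h.sign with rfl | rfl <;> constructor <;> linarith

/-- For `σ = -1` the quartic terms help: they raise the energy and lower its derivative. For `σ = 1`
the hypothesis `xρ² ≤ 1` makes `ρ⁴` at most the squared amplitude over `x²`. From `x = 4` on, the
cross term costs at most an eighth of the squared amplitude. -/
theorem estimates_of_neg_or_small (h : IsHalfLineModulus σ ρ v) {x : ℝ} (hx : 4 ≤ x)
    (hs : σ = -1 ∨ x * ρ x ^ 2 ≤ 1) :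
    sqAmplitude ρ v x ≤ 2 * correctedEnergy σ ρ v x ∧
      correctedEnergyDeriv σ ρ v x ≤ 16 * correctedEnergy σ ρ v x / x ^ 3 := by
  have hx0 : 0 < x := by linarith
  have hN := h.sqAmplitude_pos hx0
  have hG := h.correctedEnergy_sub_sqAmplitude hx0
  have h1 : |16 * (ρ x * v x) / x ^ 2| ≤ sqAmplitude ρ v x / 8 := by
    rw [abs_div, abs_mul, abs_of_pos (by norm_num : (0 : ℝ) < 16),
      abs_of_pos (by positivity : 0 < x ^ 2), div_le_iff₀ (by positivity)]
    have := eight_mul_abs_le (ρ := ρ) (v := v) hx0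
    nlinarith [mul_le_mul_of_nonneg_left (show 16 ≤ x ^ 2 by nlinarith) hN.le]
  have h1' := (abs_le.1 h1).1
  have hcr := (abs_le.1 (abs_cross_le (ρ := ρ) (v := v) hx0)).2
  have h40 : 0 ≤ ρ x ^ 4 / x := by positivity
  have h60 : 0 ≤ ρ x ^ 6 / x ^ 2 := by positivity
  have h60' : 0 ≤ ρ x ^ 6 / x := by positivity
  have h400 : 0 ≤ ρ x ^ 4 := by positivity
  have hsmall : x * ρ x ^ 2 ≤ 1 → x ^ 2 * ρ x ^ 4 ≤ sqAmplitude ρ v x := fun hs => by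
    have := mul_sq_le_sqAmplitude (ρ := ρ) (v := v) hx0
    have h0 : 0 ≤ x * ρ x ^ 2 := by positivity
    nlinarith
  have hNG : sqAmplitude ρ v x ≤ 2 * correctedEnergy σ ρ v x := by
    rcases h.sign with rfl | rfl
    · have hs' := hsmall (hs.resolve_left (by norm_num))
      have : 16 * ρ x ^ 4 ≤ x ^ 2 * ρ x ^ 4 := by gcongr; nlinarith
      linarith
    · linarith
  refine ⟨hNG, ?_⟩
  have hle : correctedEnergyDeriv σ ρ v x ≤ 8 * sqAmplitude ρ v x / x ^ 3 := by
    have h80 : 0 ≤ sqAmplitude ρ v x / x ^ 3 := by positivity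
    have e1 : 4 * sqAmplitude ρ v x / x ^ 3 = 4 * (sqAmplitude ρ v x / x ^ 3) := by ring
    have e2 : 8 * sqAmplitude ρ v x / x ^ 3 = 8 * (sqAmplitude ρ v x / x ^ 3) := by ring
    unfold correctedEnergyDeriv
    rw [mul_div_assoc (4 * σ), mul_div_assoc 4 (ρ x ^ 6)]
    rcases h.sign with rfl | rfl
    · have hs' := hsmall (hs.resolve_left (by norm_num))
      have : ρ x ^ 4 / x ≤ sqAmplitude ρ v x / x ^ 3 := by
        rw [div_le_div_iff₀ hx0 (by positivity)]
        nlinarith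
      linarith
    · linarith
  refine hle.trans ?_
  refine (div_le_div_iff_of_pos_right (by positivity)).2 ?_
  linarith

theorem bounded_of_forall_small (h : IsHalfLineModulus σ ρ v) {X : ℝ} (hX : 4 ≤ X)
    (hs : ∀ x ∈ Icc 4 X, σ = -1 ∨ x * ρ x ^ 2 ≤ 1) :
    sqAmplitude ρ v X ≤ 4 * correctedEnergy σ ρ v 4 := by
  have h4 := h.sqAmplitude_pos (x := 4) (by norm_num)
  have h4' := (h.estimates_of_neg_or_small le_rfl (hs 4 (left_mem_Icc.2 hX))).1
  have := h.correctedEnergy_le_two_mul hX (by linarith)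
    fun x hx => (h.estimates_of_neg_or_small hx.1 (hs x hx)).2
  linarith [(h.estimates_of_neg_or_small hX (hs X (right_mem_Icc.2 hX))).1]

/-- Small data stay small. -/
theorem mul_sq_le_one (h : IsHalfLineModulus σ ρ v) (h4 : correctedEnergy σ ρ v 4 ≤ 1 / 8)
    (h0 : 4 * ρ 4 ^ 2 < 1) {x : ℝ} (hx : 4 ≤ x) : x * ρ x ^ 2 ≤ 1 := by
  by_contra! hcon
  have hc : Continuous fun x => x * ρ x ^ 2 := continuous_id.mul (h.continuous_fst.pow 2)
  have hZ : IsCompact (Icc 4 x ∩ (fun x => x * ρ x ^ 2) ⁻¹' Ici 1) :=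
    isCompact_Icc.inter_right (isClosed_Ici.preimage hc)
  -- Continuity argument at the first `s` where `xρ²` reaches 1: before `s`, the bound by `4 * (1/8)
  -- = 1/2` is strictly better, and it passes to the limit at `s`.
  obtain ⟨s, ⟨hsI, hs⟩, hmin⟩ := hZ.exists_isMinOn ⟨x, ⟨hx, le_rfl⟩, hcon.le⟩ continuousOn_id
  have hs1 : 1 ≤ s * ρ s ^ 2 := hs
  have h4s : 4 < s := by
    refine lt_of_le_of_ne hsI.1 ?_
    rintro rfl
    linarith
  have hbelow : ∀ y ∈ Ico 4 s, y * ρ y ^ 2 ≤ 1 := fun y hy => by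
    by_contra! hy1
    have := hmin (a := y) ⟨⟨hy.1, hy.2.le.trans hsI.2⟩, hy1.le⟩
    have h' : s ≤ y := this
    linarith [hy.2]
  have hhalf : ∀ y ∈ Ico 4 s, y * ρ y ^ 2 ≤ 1 / 2 := fun y hy => by
    have h1 := h.bounded_of_forall_small hy.1
      fun z hz => Or.inr (hbelow z ⟨hz.1, hz.2.trans_lt hy.2⟩)
    have h2 := mul_sq_le_sqAmplitude (ρ := ρ) (v := v) (x := y) (by linarith [hy.1])
    linarith
  have : s * ρ s ^ 2 ≤ 1 / 2 := by
    refine le_of_tendsto (hc.continuousAt.tendsto.mono_left (nhdsWithin_le_nhds (s := Iio s))) ?_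
    filter_upwards [Ico_mem_nhdsLT h4s] with y hy using hhalf y hy
  linarith

/-- Boundedness of the amplitude gives convergence to a positive limit. -/
theorem exists_limit_sqAmplitude (h : IsHalfLineModulus σ ρ v) {B : ℝ}
    (hB : ∀ x, 4 ≤ x → sqAmplitude ρ v x ≤ B)
    (hG : ∀ x, 4 ≤ x → sqAmplitude ρ v x ≤ 2 * correctedEnergy σ ρ v x) :
    ∃ l > 0, ∃ K, ∀ x, 4 ≤ x → |sqAmplitude ρ v x - l| ≤ K / x ^ 2 := by
  have hpos : ∀ x, 4 ≤ x → 0 < sqAmplitude ρ v x := fun x hx => h.sqAmplitude_pos (by linarith)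
  have hGpos : ∀ x, 4 ≤ x → 0 < correctedEnergy σ ρ v x := fun x hx => by
    linarith [hpos x hx, hG x hx]
  have hB0 : 0 < B := (hpos 4 le_rfl).trans_le (hB 4 le_rfl)
  -- Chosen so that the general bound on the derivative becomes `(c/2) * sqAmplitude / x³`, hence at
  -- most `c * correctedEnergy / x³`.
  set c := 8 * (1 + B + B ^ 2)
  have hd1 : ∀ x, 4 ≤ x → |correctedEnergyDeriv σ ρ v x| ≤
      c / 2 * sqAmplitude ρ v x / x ^ 3 := fun x hx => by
    refine (h.abs_correctedEnergyDeriv_le (by linarith)).trans ?_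
    have hN := hpos x hx
    have := hB x hx
    refine (div_le_div_iff_of_pos_right (by positivity)).2 ?_
    have h2 : sqAmplitude ρ v x ^ 2 ≤ B ^ 2 := by gcongr
    simp only [c]
    nlinarith
  have hdB : ∀ x, 4 ≤ x → |correctedEnergyDeriv σ ρ v x| ≤ c / 2 * B / x ^ 3 := fun x hx => by
    refine (hd1 x hx).trans ?_
    have hx0 : 0 < x := by linarith
    have := hB x hx
    gcongr
  obtain ⟨l, hl⟩ := exists_limit_of_abs_deriv_le (by norm_num : (0 : ℝ) < 4)
    (fun x hx => h.hasDerivAt_correctedEnergy (by linarith)) hdB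
  -- This reverse Grönwall bound keeps the energy above a positive constant, so that the limit `l`
  -- is nonzero.
  have hmono : MonotoneOn (fun x => correctedEnergy σ ρ v x * Real.exp (-(c / 2) / x ^ 2))
      (Ici 4) := by
    have hd : ∀ x ∈ Ici (4 : ℝ), HasDerivAt
        (fun x => correctedEnergy σ ρ v x * Real.exp (-(c / 2) / x ^ 2))
        ((correctedEnergyDeriv σ ρ v x + c * correctedEnergy σ ρ v x / x ^ 3) *
          Real.exp (-(c / 2) / x ^ 2)) x := by
      intro x hx
      have hx0 : 0 < x := lt_of_lt_of_le (by norm_num) hx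
      have := (h.hasDerivAt_correctedEnergy hx0).mul
        (((hasDerivAt_const x (-(c / 2))).div ((hasDerivAt_id x).pow 2)
          (pow_ne_zero 2 hx0.ne')).exp)
      refine this.congr_deriv ?_
      simp
      field_simp
    refine monotoneOn_of_hasDerivWithinAt_nonneg (convex_Ici 4)
      (fun x hx => (hd x hx).continuousAt.continuousWithinAt)
      (fun x hx => (hd x (interior_subset hx)).hasDerivWithinAt) fun x hx => ?_
    have hx4 : (4 : ℝ) ≤ x := interior_subset hx
    refine mul_nonneg ?_ (Real.exp_pos _).le
    have h1 := (abs_le.1 (hd1 x hx4)).1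
    have h2 : c / 2 * sqAmplitude ρ v x / x ^ 3 ≤ c * correctedEnergy σ ρ v x / x ^ 3 := by
      have hx0 : 0 < x := by linarith
      refine (div_le_div_iff_of_pos_right (by positivity)).2 ?_
      have : 0 < c := by positivity
      nlinarith [hG x hx4]
    linarith
  have hlow : ∀ x, 4 ≤ x →
      correctedEnergy σ ρ v 4 * Real.exp (-(c / 2) / 4 ^ 2) ≤ correctedEnergy σ ρ v x := by
    intro x hx
    refine (hmono self_mem_Ici hx hx).trans ?_
    refine mul_le_of_le_one_right (hGpos x hx).le (Real.exp_le_one_iff.2 ?_)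
    exact div_nonpos_of_nonpos_of_nonneg (by simp only [c]; nlinarith) (by positivity)
  have hlim : Tendsto (correctedEnergy σ ρ v) atTop (𝓝 l) := by
    rw [tendsto_iff_dist_tendsto_zero]
    have h0 : Tendsto (fun x : ℝ => c / 2 * B / x ^ 2) atTop (𝓝 0) :=
      tendsto_const_nhds.div_atTop (tendsto_pow_atTop two_ne_zero)
    refine tendsto_of_tendsto_of_tendsto_of_le_of_le' tendsto_const_nhds h0
      (Eventually.of_forall fun _ => dist_nonneg) ?_
    filter_upwards [eventually_ge_atTop 4] with x hx
    exact hl x hx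
  refine ⟨l, ?_, c / 2 * B + (2 * B + 2 * B ^ 2 + B ^ 3), fun x hx => ?_⟩
  · exact (mul_pos (hGpos 4 le_rfl) (Real.exp_pos _)).trans_le
      (ge_of_tendsto hlim ((eventually_ge_atTop 4).mono hlow))
  · have h1 := hl x hx
    have h2 := h.abs_correctedEnergy_sub_le (x := x) (by linarith)
    have h3 : (2 * sqAmplitude ρ v x + 2 * sqAmplitude ρ v x ^ 2 + sqAmplitude ρ v x ^ 3) / x ^ 2 ≤
        (2 * B + 2 * B ^ 2 + B ^ 3) / x ^ 2 := by
      have := hB x hx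
      have := hpos x hx
      gcongr
    rw [add_div]
    rw [abs_sub_comm] at h2
    calc |sqAmplitude ρ v x - l| = |(sqAmplitude ρ v x - correctedEnergy σ ρ v x) +
          (correctedEnergy σ ρ v x - l)| := by ring_nf
      _ ≤ _ := abs_add_le _ _
      _ ≤ _ := by linarith

end IsHalfLineModulus

/-! ### Polar angle and oscillatory asymptotics -/

/-- A nonvanishing `C¹` curve in the plane has a continuous polar angle. -/
theorem exists_polar_angle {w w' : ℝ → ℂ} {a : ℝ} (hw : ∀ x, a ≤ x → HasDerivAt w (w' x) x)
    (hne : ∀ x, a ≤ x → w x ≠ 0) (hc : ContinuousOn w' (Ici a)) :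
    ∃ θ : ℝ → ℝ, Continuous θ ∧ (∀ x, a ≤ x → HasDerivAt θ (w' x / w x).im x) ∧
      ∀ x, a ≤ x → (w x).re = ‖w x‖ * Real.cos (θ x) := by
  have hwc : ContinuousOn w (Ici a) := fun x hx => (hw x hx).continuousAt.continuousWithinAt
  -- The logarithmic derivative is frozen to the left of `a`, so its primitive, a logarithm of `w`
  -- on `[a, ∞)`, is defined and continuous on the whole line.
  have hh : Continuous fun s => w' (max a s) / w (max a s) :=
    (hc.div hwc fun x hx => hne x hx).comp_continuous (continuous_const.max continuous_id)
      fun x => le_max_left a x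
  set h := fun s => w' (max a s) / w (max a s) with hdef
  set l : ℝ → ℂ := fun x => Complex.log (w a) + ∫ s in a..x, h s with hl
  have hld : ∀ x, HasDerivAt l (h x) x := fun x =>
    ((hh.integral_hasStrictDerivAt a x).hasDerivAt).const_add _
  have hha : ∀ x, a ≤ x → h x = w' x / w x := fun x hx => by simp [hdef, max_eq_right hx]
  have hconst : ∀ x, a ≤ x → w x * Complex.exp (-l x) = 1 := by
    intro x hx
    have hd : ∀ y ∈ Ici a, HasDerivAt (fun y => w y * Complex.exp (-l y)) 0 y := fun y hy => by
      refine ((hw y hy).mul ((hld y).neg.cexp)).congr_deriv ?_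
      rw [hha y hy]
      have := hne y hy
      field_simp
      ring
    have h1 := (convex_Ici a).is_const_of_fderivWithin_eq_zero (𝕜 := ℝ)
      (fun y hy => (hd y hy).differentiableAt.differentiableWithinAt)
      (fun y hy => by
        have h2 := (hd y hy).hasDerivWithinAt (s := Ici a)
        have h3 := h2.hasFDerivWithinAt.fderivWithin (uniqueDiffOn_Ici a y hy)
        rw [h3]
        ext
        simp) hx (self_mem_Ici (a := a))
    rw [h1]
    simp [hl, Complex.exp_neg, Complex.exp_log (hne a le_rfl), hne a le_rfl]
  have hexp : ∀ x, a ≤ x → w x = Complex.exp (l x) := fun x hx => by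
    have := hconst x hx
    rw [Complex.exp_neg, mul_inv_eq_one₀ (Complex.exp_ne_zero _)] at this
    exact this
  refine ⟨fun x => (l x).im, ?_, fun x hx => ?_, fun x hx => ?_⟩
  · exact Complex.continuous_im.comp
      (continuous_iff_continuousAt.2 fun x => (hld x).continuousAt)
  · rw [← hha x hx]
    exact (Complex.imCLM.hasFDerivAt (x := l x)).comp_hasDerivAt x (hld x)
  · rw [hexp x hx, Complex.norm_exp, Complex.exp_re]

namespace IsHalfLineModulus

variable {σ : ℝ} {ρ v : ℝ → ℝ}

/-- The angle is that of `w = xρ - 4iv`, for which `|w|²` is `x` times the squared amplitude. The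
sign of the second coordinate makes the rotation positive, at rate about `x/4`. -/
theorem exists_angle (h : IsHalfLineModulus σ ρ v) {B : ℝ}
    (hB : ∀ x, 4 ≤ x → sqAmplitude ρ v x ≤ B) :
    ∃ θ : ℝ → ℝ, Continuous θ ∧ Tendsto θ atTop atTop ∧
      ∀ x, 4 ≤ x → x * ρ x = Real.sqrt (x * sqAmplitude ρ v x) * Real.cos (θ x) := by
  set v' := fun x => -(ρ x / 16) * (x ^ 2 - 4 * σ * x * ρ x ^ 2 + 3 * ρ x ^ 4) with hv'
  set w : ℝ → ℂ := fun x => ((x * ρ x : ℝ) : ℂ) + ((-4 * v x : ℝ) : ℂ) * Complex.I with hw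
  set w' : ℝ → ℂ := fun x => ((ρ x + x * v x : ℝ) : ℂ) + ((-4 * v' x : ℝ) : ℂ) * Complex.I with hw'
  have hd : ∀ x, HasDerivAt w (w' x) x := fun x => by
    have h1 : HasDerivAt (fun x => x * ρ x) (ρ x + x * v x) x := by
      simpa using! (hasDerivAt_id x).mul (h.hasDerivAt_fst x)
    exact h1.ofReal_comp.add (((h.hasDerivAt_snd x).const_mul (-4)).ofReal_comp.mul_const _)
  have hre : ∀ x, (w x).re = x * ρ x := fun x => by simp [hw]
  have him : ∀ x, (w x).im = -4 * v x := fun x => by simp [hw]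
  have hre' : ∀ x, (w' x).re = ρ x + x * v x := fun x => by simp [hw']
  have him' : ∀ x, (w' x).im = -4 * v' x := fun x => by simp [hw']
  have hne : ∀ x, 4 ≤ x → w x ≠ 0 := fun x hx h0 => by
    have hx0 : x ≠ 0 := by linarith
    have h1 := hre x
    have h2 := him x
    rw [h0] at h1 h2
    simp only [Complex.zero_re, Complex.zero_im] at h1 h2
    rcases h.ne_zero x with h3 | h3
    · exact h3 ((mul_eq_zero.1 h1.symm).resolve_left hx0)
    · exact h3 (by linarith)
  have hcρ := h.continuous_fst
  have hcv := h.continuous_snd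
  have hc : Continuous w' := by
    simp only [hw', hv']
    fun_prop
  obtain ⟨θ, hθc, hθd, hθ⟩ := exists_polar_angle (fun x _ => hd x) hne hc.continuousOn
  have hnormSq : ∀ x, 4 ≤ x → Complex.normSq (w x) = x * sqAmplitude ρ v x := fun x hx => by
    have hx0 : x ≠ 0 := by linarith
    rw [Complex.normSq_apply, hre, him]
    unfold sqAmplitude
    field_simp
    ring
  refine ⟨θ, hθc, ?_, fun x hx => ?_⟩
  -- The main part of `Im (w'/w)` is `x/4`. The quartic term costs at most `B`, the cross term at
  -- most 1, and the sextic term is nonnegative.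
  · have hlow : ∀ x, 4 ≤ x → x / 4 - (B + 1) ≤ (w' x / w x).im := by
      intro x hx
      have hx0 : 0 < x := by linarith
      have hN := h.sqAmplitude_pos hx0
      rw [Complex.div_im, hnormSq x hx, hre, him, hre', him', ← sub_div, le_div_iff₀ (by positivity)]
      have hpv := (abs_le.1 (show |ρ x * v x| ≤ sqAmplitude ρ v x / 8 by
        linarith [eight_mul_abs_le (ρ := ρ) (v := v) hx0])).1
      have h4 : x ^ 2 * ρ x ^ 4 ≤ B * sqAmplitude ρ v x := by
        have h5 := mul_sq_le_sqAmplitude (ρ := ρ) (v := v) hx0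
        have h6 : 0 ≤ x * ρ x ^ 2 := by positivity
        nlinarith [hB x hx]
      have h6 : 0 ≤ x * ρ x ^ 6 := by positivity
      have hNx : x ^ 2 / 4 * sqAmplitude ρ v x = x / 4 * (x ^ 2 * ρ x ^ 2 + 16 * v x ^ 2) := by
        unfold sqAmplitude
        field_simp
      have hxN : sqAmplitude ρ v x ≤ x * sqAmplitude ρ v x := by nlinarith
      have hxB : B * sqAmplitude ρ v x ≤ x * (B * sqAmplitude ρ v x) := by
        have : 0 ≤ B * sqAmplitude ρ v x := mul_nonneg (hN.le.trans (hB x hx)) hN.le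
        nlinarith
      have e : -4 * v' x * (x * ρ x) - (ρ x + x * v x) * (-4 * v x) -
          (x ^ 2 / 4 * sqAmplitude ρ v x) =
          -σ * (x ^ 2 * ρ x ^ 4) + 3 / 4 * (x * ρ x ^ 6) + 4 * (ρ x * v x) := by
        rw [hNx]
        simp only [hv']
        ring
      have e2 : (x / 4 - (B + 1)) * (x * sqAmplitude ρ v x) = x ^ 2 / 4 * sqAmplitude ρ v x -
          x * (B * sqAmplitude ρ v x) - x * sqAmplitude ρ v x := by ring
      have h40 : 0 ≤ x ^ 2 * ρ x ^ 4 := by positivity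
      rw [e2]
      rcases h.sign with rfl | rfl <;> linarith
    have hmono : MonotoneOn (fun x => θ x - (x ^ 2 / 8 - (B + 1) * x)) (Ici 4) := by
      have hdd : ∀ x ∈ Ici (4 : ℝ), HasDerivAt (fun x => θ x - (x ^ 2 / 8 - (B + 1) * x))
          ((w' x / w x).im - (x / 4 - (B + 1))) x := fun x hx => by
        refine ((hθd x hx).sub ((((hasDerivAt_id x).pow 2).div_const 8).sub
          ((hasDerivAt_id x).const_mul (B + 1)))).congr_deriv ?_
        simp
        ring
      refine monotoneOn_of_hasDerivWithinAt_nonneg (convex_Ici 4)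
        (fun x hx => (hdd x hx).continuousAt.continuousWithinAt)
        (fun x hx => (hdd x (interior_subset hx)).hasDerivWithinAt) fun x hx => ?_
      linarith [hlow x (interior_subset hx)]
    set c := θ 4 - (4 ^ 2 / 8 - (B + 1) * 4)
    have hquad : Tendsto (fun x : ℝ => x * (x / 8 - (B + 1)) + c) atTop atTop := by
      refine tendsto_atTop_add_const_right _ _ (tendsto_id.atTop_mul_atTop₀ ?_)
      exact tendsto_atTop_add_const_right _ _ (tendsto_id.atTop_div_const (by norm_num))
    refine tendsto_atTop_mono' _ ?_ hquad
    filter_upwards [eventually_ge_atTop 4] with x hx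
    have := hmono self_mem_Ici hx hx
    simp only at this
    simp only [c]
    linarith
  · rw [← hnormSq x hx, ← Complex.norm_def, ← hre, hθ x hx]

/-- Asymptotics of bounded solutions of the modulus equation on a half-line. -/
theorem exists_asymptotics (h : IsHalfLineModulus σ ρ v) {B : ℝ}
    (hB : ∀ x, 4 ≤ x → sqAmplitude ρ v x ≤ B)
    (hG : ∀ x, 4 ≤ x → sqAmplitude ρ v x ≤ 2 * correctedEnergy σ ρ v x) :
    ∃ A : ℝ, 0 < A ∧ ∃ θ : ℝ → ℝ, Continuous θ ∧ Tendsto θ atTop atTop ∧ ∃ K, ∀ x, 4 ≤ x →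
      |ρ x - A * x ^ (-(1 / 2) : ℝ) * Real.cos (θ x)| ≤ K * x⁻¹ := by
  obtain ⟨l, hl, K, hK⟩ := h.exists_limit_sqAmplitude hB hG
  obtain ⟨θ, hθc, hθt, hθ⟩ := h.exists_angle hB
  have hA := Real.sqrt_pos.2 hl
  refine ⟨√l, hA, θ, hθc, hθt, K / √l, fun x hx => ?_⟩
  have hx0 : 0 < x := by linarith
  have hN := h.sqAmplitude_pos hx0
  have hsx : 0 < √x := Real.sqrt_pos.2 hx0
  have hρ : ρ x = √(sqAmplitude ρ v x) * (√x)⁻¹ * Real.cos (θ x) := by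
    have h1 := hθ x hx
    rw [Real.sqrt_mul hx0.le] at h1
    have h2 : √x * √x = x := Real.mul_self_sqrt hx0.le
    apply mul_left_cancel₀ hx0.ne'
    have h3 : ∀ s n c : ℝ, s ≠ 0 → s * n * c = s * s * (n * s⁻¹ * c) := fun s n c hs => by
      field_simp
    rw [h1, h3 _ _ _ hsx.ne', h2]
  have hK0 : 0 ≤ K / x ^ 2 := (abs_nonneg _).trans (hK x hx)
  have hK1 : 0 ≤ K := by
    rwa [le_div_iff₀ (by positivity), zero_mul] at hK0
  -- Since `√N - √l = (N - l)/(√N + √l)`, the rate for the squared amplitude passes to the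
  -- amplitude; only a rate `x⁻¹` is needed.
  have hdiff : |√(sqAmplitude ρ v x) - √l| ≤ K / √l * x⁻¹ := by
    have h1 : (√(sqAmplitude ρ v x) - √l) * (√(sqAmplitude ρ v x) + √l) = sqAmplitude ρ v x - l := by
      have := Real.mul_self_sqrt hN.le
      have := Real.mul_self_sqrt hl.le
      linarith [show (√(sqAmplitude ρ v x) - √l) * (√(sqAmplitude ρ v x) + √l) =
        √(sqAmplitude ρ v x) * √(sqAmplitude ρ v x) - √l * √l by ring]
    have h2 := hK x hx
    rw [← h1, abs_mul, abs_of_pos (by positivity : 0 < √(sqAmplitude ρ v x) + √l)] at h2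
    have h3 : |√(sqAmplitude ρ v x) - √l| * √l ≤ K / x ^ 2 :=
      le_trans (mul_le_mul_of_nonneg_left (by linarith [Real.sqrt_nonneg (sqAmplitude ρ v x)])
        (abs_nonneg _)) h2
    rw [← le_div_iff₀ hA] at h3
    refine h3.trans ?_
    rw [div_mul_eq_mul_div, div_eq_mul_inv K]
    gcongr
    nlinarith
  have hrp : x ^ (-(1 / 2) : ℝ) = (√x)⁻¹ := by
    rw [Real.rpow_neg hx0.le, Real.sqrt_eq_rpow]
  rw [hrp]
  have hs1 : (√x)⁻¹ ≤ 1 := inv_le_one_of_one_le₀ (Real.one_le_sqrt.2 (by linarith))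
  calc |ρ x - √l * (√x)⁻¹ * Real.cos (θ x)|
      = |√(sqAmplitude ρ v x) - √l| * (√x)⁻¹ * |Real.cos (θ x)| := by
        conv_lhs => rw [hρ]
        rw [← abs_of_pos (inv_pos.2 hsx), ← abs_mul, ← abs_mul, abs_of_pos (inv_pos.2 hsx)]
        ring_nf
    _ ≤ |√(sqAmplitude ρ v x) - √l| * 1 * 1 := by
        gcongr
        exact Real.abs_cos_le_one _
    _ ≤ _ := by linarith

end IsHalfLineModulus

/-! ### Choice of the modulus -/

/-- A global real solution of the modulus equation, bounded and with nondegenerate oscillatory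
asymptotics at both ends. -/
theorem exists_modulus :
    ∃ ρ v : ℝ → ℝ, (∀ y, HasDerivAt ρ (v y) y) ∧
      (∀ y, HasDerivAt v (-(ρ y / 16) * (y - 3 * ρ y ^ 2) * (y - ρ y ^ 2)) y) ∧
      (∃ B, ∀ y, 4 ≤ |y| → |y| * ρ y ^ 2 + 16 * v y ^ 2 / |y| ≤ B) ∧
      ∀ s : ℝ, s = 1 ∨ s = -1 → ∃ A : ℝ, 0 < A ∧ ∃ θ : ℝ → ℝ, Continuous θ ∧
        Tendsto θ atTop atTop ∧ ∃ K, ∀ x, 4 ≤ x →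
          |ρ (s * x) - A * x ^ (-(1 / 2) : ℝ) * Real.cos (θ x)| ≤ K * x⁻¹ := by
  -- The data `(1/8, 0)` at `y = 4` are nonzero and give corrected energy below `1/8`, as the
  -- continuity argument for `y > 0` requires. No smallness is needed for `y < 0`.
  obtain ⟨α, hα0, hα⟩ := exists_modulus_solution 4 (1 / 8, 0)
  have hne := modulus_ne_zero hα (t₀ := 4) (by rw [hα0]; simp [Prod.ext_iff])
  have hne' : ∀ t, (α t).1 ≠ 0 ∨ (α t).2 ≠ 0 := fun t => by
    by_contra! hc
    exact hne t (Prod.ext hc.1 hc.2)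
  have h1 : ∀ t, HasDerivAt (fun t => (α t).1) (α t).2 t := fun t =>
    (hasFDerivAt_fst (𝕜 := ℝ) (p := α t)).comp_hasDerivAt t (hα t)
  have h2 : ∀ t, HasDerivAt (fun t => (α t).2)
      (-((α t).1 / 16) * (t - 3 * (α t).1 ^ 2) * (t - (α t).1 ^ 2)) t := fun t =>
    (hasFDerivAt_snd (𝕜 := ℝ) (p := α t)).comp_hasDerivAt t (hα t)
  have hp : IsHalfLineModulus 1 (fun x => (α x).1) (fun x => (α x).2) :=
    ⟨Or.inl rfl, h1, fun x => (h2 x).congr_deriv (by ring), hne'⟩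
  have hm : IsHalfLineModulus (-1) (fun x => (α (-x)).1) (fun x => -(α (-x)).2) := by
    refine ⟨Or.inr rfl, fun x => ?_, fun x => ?_, fun x => ?_⟩
    · exact ((h1 (-x)).scomp x (hasDerivAt_neg x)).congr_deriv (by simp)
    · refine (((h2 (-x)).scomp x (hasDerivAt_neg x)).neg).congr_deriv ?_
      simp
      ring
    · simpa using hne' (-x)
  have h4 : correctedEnergy 1 (fun x => (α x).1) (fun x => (α x).2) 4 ≤ 1 / 8 := by
    simp only [correctedEnergy, hα0]
    norm_num
  have hsmall : ∀ x, 4 ≤ x → (1 : ℝ) = -1 ∨ x * (α x).1 ^ 2 ≤ 1 := fun x hx =>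
    Or.inr (hp.mul_sq_le_one h4 (by simp only [hα0]; norm_num) hx)
  have hBp := fun x (hx : (4 : ℝ) ≤ x) => hp.bounded_of_forall_small hx fun z hz => hsmall z hz.1
  have hBm := fun x (hx : (4 : ℝ) ≤ x) => hm.bounded_of_forall_small hx fun z _ => Or.inl rfl
  refine ⟨fun t => (α t).1, fun t => (α t).2, h1, h2,
    ⟨max (4 * correctedEnergy 1 (fun x => (α x).1) (fun x => (α x).2) 4)
      (4 * correctedEnergy (-1) (fun x => (α (-x)).1) (fun x => -(α (-x)).2) 4), fun y hy => ?_⟩, ?_⟩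
  · rcases abs_cases y with ⟨h, -⟩ | ⟨h, -⟩ <;> rw [h] at hy ⊢
    · exact le_max_of_le_left (hBp y hy)
    · refine le_max_of_le_right (le_trans ?_ (hBm (-y) hy))
      simp [sqAmplitude]
  · rintro s (rfl | rfl)
    · simpa using hp.exists_asymptotics hBp
        fun x hx => (hp.estimates_of_neg_or_small hx (hsmall x hx)).1
    · simpa using hm.exists_asymptotics hBm
        fun x hx => (hm.estimates_of_neg_or_small hx (Or.inl rfl)).1

/-! ### From the profile equation to the self-similar solution -/

theorem contDiff_two_of_hasDerivAt {Q Q₁ Q₂ : ℝ → ℂ} (h : ∀ y, HasDerivAt Q (Q₁ y) y)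
    (h₁ : ∀ y, HasDerivAt Q₁ (Q₂ y) y) (h₂ : Continuous Q₂) : ContDiff ℝ 2 Q := by
  have hd : deriv Q = Q₁ := funext fun y => (h y).deriv
  have hd₁ : deriv Q₁ = Q₂ := funext fun y => (h₁ y).deriv
  rw [show (2 : WithTop ℕ∞) = 1 + 1 by norm_num, contDiff_succ_iff_deriv, hd,
    contDiff_one_iff_deriv, hd₁]
  exact ⟨fun y => (h y).differentiableAt, by simp, fun y => (h₁ y).differentiableAt, h₂⟩

/-- The self-similar function built on a solution of the profile equation solves the derivative
nonlinear Schrödinger equation. -/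
theorem isDNLSSolution_selfSimilar {Q Q₁ Q₂ N₁ : ℝ → ℂ} (h : ∀ y, HasDerivAt Q (Q₁ y) y)
    (h₁ : ∀ y, HasDerivAt Q₁ (Q₂ y) y) (h₂ : Continuous Q₂)
    (hN : ∀ y, HasDerivAt (fun z => (‖Q z‖ : ℂ) ^ 2 * Q z) (N₁ y) y)
    (heq : ∀ y : ℝ, Q₂ y - Complex.I / 2 * (y * Q₁ y + Q y / 2) + Complex.I * N₁ y = 0) :
    IsDNLSSolution (selfSimilar Q) Q := by
  have hQ := contDiff_two_of_hasDerivAt h h₁ h₂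
  refine ⟨?_, fun t _ => ?_, fun t ht x => ?_, fun x => by simp [selfSimilar]⟩
  · have hpow : ∀ c : ℝ, ContDiffOn ℝ 1 (fun p : ℝ × ℝ => p.1 ^ c) (Ici 1 ×ˢ univ) := fun c =>
      contDiff_fst.contDiffOn.rpow_const_of_ne fun p hp => by
        have : (1 : ℝ) ≤ p.1 := hp.1
        positivity
    exact (Complex.ofRealCLM.contDiff.comp_contDiffOn (hpow _)).mul
      ((hQ.of_le (by norm_num)).comp_contDiffOn ((hpow _).mul contDiff_snd.contDiffOn))
  · exact contDiff_const.mul (hQ.comp (contDiff_const.mul contDiff_id))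
  · have ht0 : 0 < t := by linarith
    set c : ℝ := t ^ (-(1 / 4) : ℝ) with hc
    set s : ℝ := t ^ (-(1 / 2) : ℝ) with hs
    have hcs : c ^ 2 = s := by
      rw [hc, hs, ← Real.rpow_natCast, ← Real.rpow_mul ht0.le]
      norm_num
    have hst : s ^ 2 * t = 1 := by
      rw [hs, ← Real.rpow_natCast, ← Real.rpow_mul ht0.le]
      norm_num
      rw [Real.rpow_neg_one, inv_mul_cancel₀ ht0.ne']
    have hc0 : 0 ≤ c := Real.rpow_nonneg ht0.le _
    have hcd : HasDerivAt (fun r : ℝ => r ^ (-(1 / 4) : ℝ)) (-(1 / 4) * (c * s ^ 2)) t := by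
      refine (Real.hasDerivAt_rpow_const (Or.inl ht0.ne')).congr_deriv ?_
      rw [Real.rpow_sub ht0, Real.rpow_one, ← hc, eq_div_of_mul_eq ht0.ne' hst]
      ring
    have hsd : HasDerivAt (fun r : ℝ => r ^ (-(1 / 2) : ℝ)) (-(1 / 2) * (s * s ^ 2)) t := by
      refine (Real.hasDerivAt_rpow_const (Or.inl ht0.ne')).congr_deriv ?_
      rw [Real.rpow_sub ht0, Real.rpow_one, ← hs, eq_div_of_mul_eq ht0.ne' hst]
      ring
    have hut : selfSimilar Q t = fun x => (c : ℂ) * Q (s * x) := rfl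
    have hline : ∀ x : ℝ, HasDerivAt (fun x : ℝ => s * x) s x := fun x => by
      simpa using (hasDerivAt_id x).const_mul s
    have hscale : ∀ {f f' : ℝ → ℂ}, (∀ y, HasDerivAt f (f' y) y) → ∀ (k : ℂ) (x : ℝ),
        HasDerivAt (fun x => k * f (s * x)) (k * s * f' (s * x)) x := fun {f f'} hf k x => by
      refine (((hf (s * x)).scomp x (hline x)).const_mul k).congr_deriv ?_
      rw [Complex.real_smul]
      ring
    have htime : HasDerivAt (fun r => selfSimilar Q r x)
        (((-(1 / 4) * (c * s ^ 2) : ℝ) : ℂ) * Q (s * x) +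
          c * (((-(1 / 2) * (s * s ^ 2) * x : ℝ) : ℂ) * Q₁ (s * x))) t := by
      refine (hcd.ofReal_comp.mul ((h (s * x)).scomp t (hsd.mul_const x))).congr_deriv ?_
      rw [Complex.real_smul]
      rfl
    have hsp : iteratedDeriv 2 (selfSimilar Q t) x = c * s * s * Q₂ (s * x) := by
      have e1 : deriv (selfSimilar Q t) = fun x => (c * s : ℂ) * Q₁ (s * x) :=
        funext fun x => (hscale h c x).deriv
      rw [iteratedDeriv_succ, iteratedDeriv_one, e1]
      exact (hscale h₁ _ x).deriv
    have hnl : deriv (fun z => (‖selfSimilar Q t z‖ : ℂ) ^ 2 * selfSimilar Q t z) x =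
        c ^ 3 * s * N₁ (s * x) := by
      have e1 : (fun z => (‖selfSimilar Q t z‖ : ℂ) ^ 2 * selfSimilar Q t z) =
          fun z => (c ^ 3 : ℂ) * ((‖Q (s * z)‖ : ℂ) ^ 2 * Q (s * z)) := by
        funext z
        rw [hut]
        simp only [norm_mul, Complex.norm_real, Real.norm_eq_abs, abs_of_nonneg hc0]
        push_cast
        ring
      rw [e1]
      exact (hscale hN _ x).deriv
    rw [htime.hasDerivWithinAt.derivWithin (uniqueDiffOn_Ici 1 t ht), hsp, hnl]
    have hcs' : (c : ℂ) ^ 2 = s := by exact_mod_cast hcs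
    have hq := heq (s * x)
    push_cast at hq ⊢
    -- The equation for `u` is `c s²` times the profile equation at `s x`; the cubic term carries
    -- `c³ s`, which matches because `c² = s`.
    linear_combination (c * s ^ 2 : ℂ) * hq + Complex.I * c * s * N₁ (s * x) * hcs'

/-! ### Profile space, rescaling and assembly -/

theorem bounded_of_sq_le {f : ℝ → ℝ} (hf : Continuous f) {D : ℝ}
    (hD : ∀ y, 4 ≤ |y| → f y ^ 2 ≤ D) : ∃ C, ∀ y, f y ≤ C := by
  obtain ⟨C, hC⟩ := (isCompact_Icc (a := (-4 : ℝ)) (b := 4)).exists_bound_of_continuousOn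
    hf.continuousOn
  refine ⟨max C (1 + D), fun y => ?_⟩
  rcases le_total |y| 4 with h | h
  · exact le_max_of_le_left ((le_abs_self _).trans (hC y (abs_le.1 h)))
  · exact le_max_of_le_right (by nlinarith [hD y h, sq_nonneg (f y - 1)])

/-- The factor `|x|^{-1/2}` absorbs `t^{-1/4}` exactly, so the leading term is self-similar. In the
error, the prefactor `t^{-1/4} ≤ 1` is simply dropped. -/
theorem norm_selfSimilar_sub_leadingTerm_le {Q : ℝ → ℂ} {a C t x : ℝ} {ω φ : ℝ → ℝ} (ht : 1 ≤ t)
    (h : ‖Q (t ^ (-(1 / 2) : ℝ) * x) - leadingTerm a ω φ (t ^ (-(1 / 2) : ℝ) * x)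
      ((t ^ (-(1 / 2) : ℝ) * x) ^ 2)‖ ≤ C * |t ^ (-(1 / 2) : ℝ) * x|⁻¹) :
    ‖selfSimilar Q t x - leadingTerm a ω φ x (x ^ 2 / t)‖ ≤ C * t ^ (1 / 2 : ℝ) * |x|⁻¹ := by
  have ht0 : 0 < t := by linarith
  have hs0 : 0 < t ^ (-(1 / 2) : ℝ) := Real.rpow_pos_of_pos ht0 _
  have hc0 : 0 < t ^ (-(1 / 4) : ℝ) := Real.rpow_pos_of_pos ht0 _
  have hsq : (t ^ (-(1 / 2) : ℝ) * x) ^ 2 = x ^ 2 / t := by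
    rw [mul_pow, ← Real.rpow_natCast (t ^ (-(1 / 2) : ℝ)), ← Real.rpow_mul ht0.le]
    norm_num
    rw [Real.rpow_neg_one]
    ring
  have hpow : |t ^ (-(1 / 2) : ℝ) * x| ^ (-(1 / 2) : ℝ) * t ^ (-(1 / 4) : ℝ) =
      |x| ^ (-(1 / 2) : ℝ) := by
    rw [abs_mul, abs_of_pos hs0, Real.mul_rpow hs0.le (abs_nonneg x), ← Real.rpow_mul ht0.le,
      mul_right_comm, ← Real.rpow_add ht0]
    norm_num
  have hlead : leadingTerm a ω φ x (x ^ 2 / t) = ((t ^ (-(1 / 4) : ℝ) : ℝ) : ℂ) *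
      leadingTerm a ω φ (t ^ (-(1 / 2) : ℝ) * x) ((t ^ (-(1 / 2) : ℝ) * x) ^ 2) := by
    unfold leadingTerm
    rw [hsq, ← hpow]
    push_cast
    ring
  have hinv : |t ^ (-(1 / 2) : ℝ) * x|⁻¹ = t ^ (1 / 2 : ℝ) * |x|⁻¹ := by
    rw [abs_mul, abs_of_pos hs0, mul_inv, Real.rpow_neg ht0.le, inv_inv]
  rw [hlead, selfSimilar, ← mul_sub, norm_mul, Complex.norm_real, Real.norm_eq_abs,
    abs_of_pos hc0, mul_assoc, ← hinv]
  exact (mul_le_of_le_one_left (norm_nonneg _)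
    (Real.rpow_le_one_of_one_le_of_nonpos ht (by norm_num))).trans h

/-- Bounded squared amplitude gives `ρ² = O(1/|y|)` and `v² = O(|y|)`. In `Q'` the phase contributes
about `yρ/4`, which also grows at most like `|y|^{1/2}`. -/
theorem mem_profileSpace_of_modulus {Q Q₁ Q₂ : ℝ → ℂ} {ρ v : ℝ → ℝ} {B : ℝ}
    (h : ∀ y, HasDerivAt Q (Q₁ y) y) (h₁ : ∀ y, HasDerivAt Q₁ (Q₂ y) y) (h₂ : Continuous Q₂)
    (hQ : ∀ y, ‖Q y‖ ^ 2 = ρ y ^ 2)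
    (hQ₁ : ∀ y, ‖Q₁ y‖ ^ 2 = v y ^ 2 + ((y / 4 - 3 / 4 * ρ y ^ 2) * ρ y) ^ 2)
    (hB : ∀ y, 4 ≤ |y| → |y| * ρ y ^ 2 + 16 * v y ^ 2 / |y| ≤ B) : Q ∈ profileSpace := by
  have hbc : Continuous japaneseBracket := by
    unfold japaneseBracket
    fun_prop
  have hbsq : ∀ y, japaneseBracket y ^ 2 = 1 + |y| ^ 2 := fun y => Real.sq_sqrt (by positivity)
  have hbpos : ∀ y, 0 < japaneseBracket y := fun y => Real.sqrt_pos.2 (by positivity)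
  have hrc : ∀ c : ℝ, Continuous fun y => japaneseBracket y ^ c := fun c =>
    hbc.rpow_const fun y => Or.inl (hbpos y).ne'
  have hble : ∀ y, 4 ≤ |y| → |y| ≤ japaneseBracket y ∧ japaneseBracket y ≤ 2 * |y| := fun y hy =>
    ⟨by nlinarith [hbsq y, hbpos y], by nlinarith [hbsq y, hbpos y]⟩
  have hQc : Continuous Q := continuous_iff_continuousAt.2 fun y => (h y).continuousAt
  have hQ₁c : Continuous Q₁ := continuous_iff_continuousAt.2 fun y => (h₁ y).continuousAt
  have hbound : ∀ y, 4 ≤ |y| → 0 ≤ |y| * ρ y ^ 2 ∧ |y| * ρ y ^ 2 ≤ B ∧ v y ^ 2 / |y| ≤ B := by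
    intro y hy
    have h1 := hB y hy
    have h2 : 0 ≤ |y| * ρ y ^ 2 := by positivity
    have h3 : 0 ≤ v y ^ 2 / |y| := by positivity
    rw [mul_div_assoc] at h1
    exact ⟨h2, by linarith, by linarith⟩
  refine ⟨contDiff_two_of_hasDerivAt h h₁ h₂, ?_, ?_⟩
  · refine bounded_of_sq_le (D := 2 * B) ((hrc _).mul hQc.norm) fun y hy => ?_
    have e : (japaneseBracket y ^ (1 / 2 : ℝ)) ^ 2 = japaneseBracket y := by
      rw [← Real.sqrt_eq_rpow, Real.sq_sqrt (hbpos y).le]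
    rw [mul_pow, e, hQ]
    nlinarith [(hble y hy).2, (hbound y hy).2.1, sq_nonneg (ρ y)]
  · rw [show deriv Q = Q₁ from funext fun y => (h y).deriv]
    refine bounded_of_sq_le (D := B + (B + 2 * B ^ 3)) ((hrc _).mul hQ₁c.norm) fun y hy => ?_
    have e : (japaneseBracket y ^ (-(1 / 2) : ℝ)) ^ 2 = (japaneseBracket y)⁻¹ := by
      rw [Real.rpow_neg (hbpos y).le, ← Real.sqrt_eq_rpow, inv_pow, Real.sq_sqrt (hbpos y).le]
    obtain ⟨h0, h1, h2⟩ := hbound y hy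
    have hy0 : 0 < |y| := by linarith
    rw [mul_pow, e, hQ₁]
    have hinv : (japaneseBracket y)⁻¹ ≤ |y|⁻¹ := inv_anti₀ hy0 (hble y hy).1
    refine (mul_le_mul_of_nonneg_right hinv (by positivity)).trans ?_
    rw [mul_add, inv_mul_eq_div, inv_mul_eq_div]
    refine add_le_add h2 ?_
    rw [div_le_iff₀ hy0]
    have hy2 : |y| ^ 2 = y ^ 2 := sq_abs y
    have h3 : ((y / 4 - 3 / 4 * ρ y ^ 2) * ρ y) ^ 2 ≤
        y ^ 2 * ρ y ^ 2 + 2 * ρ y ^ 6 := by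
      nlinarith [mul_nonneg (sq_nonneg (y / 4 + 3 / 4 * ρ y ^ 2)) (sq_nonneg (ρ y)),
        mul_nonneg (sq_nonneg y) (sq_nonneg (ρ y)), sq_nonneg (ρ y ^ 3)]
    have h4 : y ^ 2 * ρ y ^ 2 ≤ B * |y| := by
      rw [← hy2]
      nlinarith
    have h5 : ρ y ^ 6 ≤ B ^ 3 * |y| := by
      have h6 : (|y| * ρ y ^ 2) ^ 3 ≤ B ^ 3 := pow_le_pow_left₀ h0 h1 3
      have h7 : ρ y ^ 6 ≤ |y| ^ 3 * ρ y ^ 6 :=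
        le_mul_of_one_le_left (by positivity) (one_le_pow₀ (by linarith))
      have h8 : B ^ 3 ≤ B ^ 3 * |y| := le_mul_of_one_le_right (by have := h0.trans h1; positivity)
        (by linarith)
      linarith [show (|y| * ρ y ^ 2) ^ 3 = |y| ^ 3 * ρ y ^ 6 by ring]
    linarith

/-- The profile, its derivatives and the profile equation in polar form. -/
theorem exists_profile {ρ v : ℝ → ℝ} (hρ : ∀ y, HasDerivAt ρ (v y) y)
    (hv : ∀ y, HasDerivAt v (-(ρ y / 16) * (y - 3 * ρ y ^ 2) * (y - ρ y ^ 2)) y) {B : ℝ}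
    (hB : ∀ y, 4 ≤ |y| → |y| * ρ y ^ 2 + 16 * v y ^ 2 / |y| ≤ B) :
    ∃ φ : ℝ → ℝ, Continuous φ ∧
      (fun y => (ρ y : ℂ) * Complex.exp (Complex.I * (φ y : ℂ))) ∈ profileSpace ∧
      IsDNLSSolution (selfSimilar fun y => (ρ y : ℂ) * Complex.exp (Complex.I * (φ y : ℂ)))
        fun y => (ρ y : ℂ) * Complex.exp (Complex.I * (φ y : ℂ)) := by
  have hρc : Continuous ρ := continuous_iff_continuousAt.2 fun x => (hρ x).continuousAt
  have hvc : Continuous v := continuous_iff_continuousAt.2 fun x => (hv x).continuousAt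
  -- This phase derivative makes the imaginary part of the profile equation vanish identically; the
  -- real part is then the modulus equation.
  set ψ : ℝ → ℝ := fun y => y / 4 - 3 / 4 * ρ y ^ 2 with hψ
  have hψc : Continuous ψ := by fun_prop
  have hψd : ∀ y, HasDerivAt ψ (1 / 4 - 3 / 2 * (ρ y * v y)) y := fun y => by
    refine (((hasDerivAt_id y).div_const 4).sub (((hρ y).pow 2).const_mul (3 / 4))).congr_deriv ?_
    simp
    ring
  set φ : ℝ → ℝ := fun y => ∫ s in (0 : ℝ)..y, ψ s with hφ
  have hφd : ∀ y, HasDerivAt φ (ψ y) y := fun y => (hψc.integral_hasStrictDerivAt 0 y).hasDerivAt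
  have hφc : Continuous φ := continuous_iff_continuousAt.2 fun x => (hφd x).continuousAt
  set e : ℝ → ℂ := fun y => Complex.exp (Complex.I * (φ y : ℂ)) with he
  have hed : ∀ y, HasDerivAt e (e y * (Complex.I * ψ y)) y := fun y =>
    ((hφd y).ofReal_comp.const_mul Complex.I).cexp
  have hec : Continuous e := by fun_prop
  have hen : ∀ y, ‖e y‖ = 1 := fun y => by
    simp only [he]
    rw [mul_comm, Complex.norm_exp_ofReal_mul_I]
  set v' : ℝ → ℝ := fun y => -(ρ y / 16) * (y - 3 * ρ y ^ 2) * (y - ρ y ^ 2) with hv'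
  set Q : ℝ → ℂ := fun y => (ρ y : ℂ) * e y with hQ
  set Q₁ : ℝ → ℂ := fun y => ((v y : ℂ) + ((ψ y * ρ y : ℝ) : ℂ) * Complex.I) * e y with hQ₁
  set Q₂ : ℝ → ℂ := fun y => ((v' y : ℂ) +
    (((1 / 4 - 3 / 2 * (ρ y * v y)) * ρ y + ψ y * v y : ℝ) : ℂ) * Complex.I) * e y +
    ((v y : ℂ) + ((ψ y * ρ y : ℝ) : ℂ) * Complex.I) * (e y * (Complex.I * ψ y)) with hQ₂
  have hd : ∀ y, HasDerivAt Q (Q₁ y) y := fun y => by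
    refine ((hρ y).ofReal_comp.mul (hed y)).congr_deriv ?_
    simp only [hQ₁]
    push_cast
    ring
  have hd₁ : ∀ y, HasDerivAt Q₁ (Q₂ y) y := fun y =>
    ((hv y).ofReal_comp.add (((hψd y).mul (hρ y)).ofReal_comp.mul_const Complex.I)).mul (hed y)
  have hc₂ : Continuous Q₂ := by
    have : Continuous v' := by fun_prop
    simp only [hQ₂]
    fun_prop
  have hnorm : ∀ y, ‖Q y‖ ^ 2 = ρ y ^ 2 := fun y => by
    simp [hQ, hen]
  have hN : ∀ y, HasDerivAt (fun z => (‖Q z‖ : ℂ) ^ 2 * Q z)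
      (((2 * ρ y * v y : ℝ) : ℂ) * Q y + ((ρ y ^ 2 : ℝ) : ℂ) * Q₁ y) y := fun y => by
    have e1 : (fun z => (‖Q z‖ : ℂ) ^ 2 * Q z) = fun z => ((ρ z ^ 2 : ℝ) : ℂ) * Q z := by
      funext z
      rw [← hnorm z]
      push_cast
      rfl
    rw [e1]
    refine (((hρ y).pow 2).ofReal_comp.mul (hd y)).congr_deriv ?_
    simp
  refine ⟨φ, hφc, ?_, ?_⟩
  · refine mem_profileSpace_of_modulus hd hd₁ hc₂ hnorm (fun y => ?_) hB
    simp only [hQ₁]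
    rw [norm_mul, hen, mul_one, Complex.sq_norm, Complex.normSq_add_mul_I]
  · refine isDNLSSolution_selfSimilar hd hd₁ hc₂ hN fun y => ?_
    simp only [hQ, hQ₁, hQ₂, hv', hψ]
    push_cast
    ring_nf
    simp only [Complex.I_sq]
    ring

theorem norm_profile_sub_leadingTerm_le {ρ φ θ : ℝ → ℝ} {A K s : ℝ} (hs : s = 1 ∨ s = -1)
    (hK : ∀ x, 4 ≤ x → |ρ (s * x) - A * x ^ (-(1 / 2) : ℝ) * Real.cos (θ x)| ≤ K * x⁻¹)
    {x : ℝ} (hx : 4 ≤ x) :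
    ‖(ρ (s * x) : ℂ) * Complex.exp (Complex.I * (φ (s * x) : ℂ)) -
      leadingTerm A (fun η => -θ √η) (fun η => φ (s * √η)) (s * x) ((s * x) ^ 2)‖ ≤
        K * |s * x|⁻¹ := by
  have hx0 : 0 < x := by linarith
  have hsx : |s * x| = x := by rcases hs with rfl | rfl <;> simp [abs_of_pos hx0]
  have hsq : √((s * x) ^ 2) = x := by rw [Real.sqrt_sq_eq_abs, hsx]
  unfold leadingTerm
  beta_reduce
  rw [hsx, hsq, Real.cos_neg, ← sub_mul, ← Complex.ofReal_sub, norm_mul, mul_comm Complex.I,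
    Complex.norm_exp_ofReal_mul_I, mul_one, Complex.norm_real]
  exact hK x hx

theorem theorem1p2 :
    ∃ Q : ℝ → ℂ, Q ∈ profileSpace ∧ IsDNLSSolution (selfSimilar Q) Q ∧
      ∃ (Qp Qm : ℝ) (ωp ωm φp φm : ℝ → ℝ),
        Qp ≠ 0 ∧ Qm ≠ 0 ∧
        ContinuousOn ωp (Ioi 0) ∧ ContinuousOn ωm (Ioi 0) ∧
        ContinuousOn φp (Ioi 0) ∧ ContinuousOn φm (Ioi 0) ∧
        Tendsto ωp atTop atBot ∧ Tendsto ωm atTop atBot ∧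
        ((fun y : ℝ => Q y - leadingTerm Qp ωp φp y (y ^ 2)) =O[atTop] fun y : ℝ => |y|⁻¹) ∧
        ((fun y : ℝ => Q y - leadingTerm Qm ωm φm y (y ^ 2)) =O[atBot] fun y : ℝ => |y|⁻¹) ∧
        ∃ C K : ℝ, 0 < C ∧ 0 < K ∧ ∀ t : ℝ, 1 ≤ t →
          (∀ x : ℝ, K * t ^ (1 / 2 : ℝ) ≤ x →
            ‖selfSimilar Q t x - leadingTerm Qp ωp φp x (x ^ 2 / t)‖
              ≤ C * t ^ (1 / 2 : ℝ) * |x|⁻¹) ∧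
          (∀ x : ℝ, x ≤ -(K * t ^ (1 / 2 : ℝ)) →
            ‖selfSimilar Q t x - leadingTerm Qm ωm φm x (x ^ 2 / t)‖
              ≤ C * t ^ (1 / 2 : ℝ) * |x|⁻¹) := by
  
  obtain ⟨ρ, v, hρ, hv, ⟨B, hB⟩, hasym⟩ := exists_modulus
  obtain ⟨φ, hφ, hmem, hsol⟩ := exists_profile hρ hv hB
  obtain ⟨Ap, hAp, θp, hθpc, hθpt, Kp, hKp⟩ := hasym 1 (Or.inl rfl)
  obtain ⟨Am, hAm, θm, hθmc, hθmt, Km, hKm⟩ := hasym (-1) (Or.inr rfl)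
  set Q : ℝ → ℂ := fun y => (ρ y : ℂ) * Complex.exp (Complex.I * (φ y : ℂ))
  have hsqrt : Tendsto Real.sqrt atTop atTop := Real.tendsto_sqrt_atTop
  have hp : ∀ y : ℝ, 4 ≤ y → ‖Q y - leadingTerm Ap (fun η => -θp √η) (fun η => φ (1 * √η)) y
      (y ^ 2)‖ ≤ max 1 (max Kp Km) * |y|⁻¹ := fun y hy => by
    have := norm_profile_sub_leadingTerm_le (φ := φ) (Or.inl rfl) hKp hy
    rw [one_mul] at this
    exact this.trans (by gcongr; exact (le_max_left _ _).trans (le_max_right _ _))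
  have hm : ∀ y : ℝ, y ≤ -4 → ‖Q y - leadingTerm Am (fun η => -θm √η) (fun η => φ (-1 * √η)) y
      (y ^ 2)‖ ≤ max 1 (max Kp Km) * |y|⁻¹ := fun y hy => by
    have := norm_profile_sub_leadingTerm_le (φ := φ) (Or.inr rfl) hKm (x := -y) (by linarith)
    rw [neg_one_mul, neg_neg] at this
    exact this.trans (by gcongr; exact (le_max_right _ _).trans (le_max_right _ _))
  -- Since cosine is even, `-θ` replaces `θ` and yields the limit `-∞`. The square root recovers
  -- `|y|` from `η = y²`. The constant 4 is where the profile asymptotics begin.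
  refine ⟨Q, hmem, hsol, Ap, Am, fun η => -θp √η, fun η => -θm √η, fun η => φ (1 * √η),
    fun η => φ (-1 * √η), hAp.ne', hAm.ne', ?_, ?_, ?_, ?_, ?_, ?_, ?_, ?_,
    max 1 (max Kp Km), 4, by positivity, by norm_num, fun t ht => ⟨fun x hx => ?_, fun x hx => ?_⟩⟩
  · exact (hθpc.comp Real.continuous_sqrt).neg.continuousOn
  · exact (hθmc.comp Real.continuous_sqrt).neg.continuousOn
  · exact (hφ.comp (continuous_const.mul Real.continuous_sqrt)).continuousOn
  · exact (hφ.comp (continuous_const.mul Real.continuous_sqrt)).continuousOn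
  · exact tendsto_neg_atTop_atBot.comp (hθpt.comp hsqrt)
  · exact tendsto_neg_atTop_atBot.comp (hθmt.comp hsqrt)
  · refine IsBigO.of_bound (max 1 (max Kp Km)) ?_
    filter_upwards [eventually_ge_atTop 4] with y hy
    simpa using! hp y hy
  · refine IsBigO.of_bound (max 1 (max Kp Km)) ?_
    filter_upwards [eventually_le_atBot (-4)] with y hy
    simpa using! hm y hy
  all_goals
    have ht0 : 0 < t := by linarith
    have hs0 : 0 < t ^ (-(1 / 2) : ℝ) := Real.rpow_pos_of_pos ht0 _
    have hone : t ^ (-(1 / 2) : ℝ) * t ^ (1 / 2 : ℝ) = 1 := by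
      rw [← Real.rpow_add ht0]
      norm_num
  · exact norm_selfSimilar_sub_leadingTerm_le ht (hp _ (by nlinarith))
  · exact norm_selfSimilar_sub_leadingTerm_le ht (hm _ (by nlinarith))
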